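/- All graphs are finite and simple. A class of graphs is hereditary if it is closed under isomorphism and induced subgraphs. The graph-intersection of two classes $\mathcal G_1,\mathcal G_2$ is the class of all graphs $(V(G_1)\cap V(G_2),E(G_1)\cap E(G_2))$ with $G_1\in\mathcal G_1$, $G_2\in\mathcal G_2$. A graph is trivially perfect if in each of its non-null induced subgraphs the independence number equals the number of maximal cliques. A graph is strongly chordal if it has no induced cycle of length at least $4$ and every (not necessarily induced) cycle $v_1\cdots v_{2l}$ with $l\ge 3$ has an odd chord, i.e. a chord $v_iv_j$ with $i\not\equiv j \pmod 2$. Burling graphs. Families $\mathcal B_k$ of axis-parallel boxes in $\mathbb R^3$ and families $\mathcal P_k$ of rectangles in the $yz$-plane ("probes") are defined recursively. $\mathcal B_1=\{[0,1]^3\}$, $\mathcal P_1=\{[0,1]^2\}$, $w_1=1$. Given $\mathcal B_k$, $\mathcal P_k$, $w_k$, for $P=[y_0,y_1]\times[z_0,z_1]\in\mathcal P_k$ let $\phi_P$ be the increasing coordinatewise affine map of $[0,1]^2$ onto $[y_0,y_1]\times[z_0,\tfrac{z_0+z_1}{2}]$, and for $Q\in\mathcal P_k$ write $\phi_P(Q)=[a,b]\times[c,d]$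 and $\delta=\tfrac{b-a}{3}$. Then $\mathcal B_{k+1}$ consists of the boxes of $\mathcal B_k$ translated by $w_k+1$ in direction $x$, of the boxes $I\times\phi_P(R)$ for $P\in\mathcal P_k$, $I\times R\in\mathcal B_k$, and of the boxes $[0,w_k]\times[a,a+\delta]\times[d,z_1]$ for $P,Q\in\mathcal P_k$; $\mathcal P_{k+1}$ consists of the rectangles $[b-\delta,b]\times[c,d]$ and $[a,a+\delta]\times[z_1-\tfrac{z_1-z_0}{4},z_1]$ for $P,Q\in\mathcal P_k$; and $w_{k+1}=2w_k+1$. Let $G_k$ be the intersection graph of $\mathcal B_k$ (two distinct boxes are adjacent if they intersect). A Burling graph is a graph isomorphic to an induced subgraph of some $G_k$, $k\ge1$. Burling strongly chordal graphs. A Burling tree $(T,r,l,c)$ consists of a finite tree $T$ with root $r$, a function $l$ that assigns to each non-leaf vertex $v$ one child of $v$, called the last-born of $v$ (a leaf is a vertex without children), and a function $c$ from $V(T)$ to subsets of $V(T)$ such that $c(v)=\emptyset$ if $v$ is the root or a last-born, and otherwise $c(v)$ is empty or the vertex set of a branch starting at the last-born of the parent of $v$. Here a branch is a path each of whose vertices,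 except the first, is a child of the previous one; it is principal if it starts at $r$ and ends at a leaf. Let $C(T)$ be the graph on $V(T)$ in which two distinct vertices $u,v$ are adjacent if and only if $v\in c(u)$, or $u\in c(v)$, or some principal branch contains both. A graph is Burling strongly chordal if it is isomorphic to an induced subgraph of $C(T)$ for some Burling tree $(T,r,l,c)$. **Theorem.** The class of Burling strongly chordal graphs is a hereditary, proper subclass of the class of strongly chordal graphs, and every Burling graph belongs to the graph-intersection of the class of trivially perfect graphs with the class of Burling strongly chordal graphs. -/

import Mathlib

/-! ### Finite graphs and graph classes -/

/-- A finite simple graph. Finite graphs up to isomorphism all live in `Type`. -/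
structure FinGraph where
  V : Type
  [finite : Finite V]
  graph : SimpleGraph V

attribute [instance] FinGraph.finite

/-- A class of graphs is hereditary if it is closed under isomorphism and induced subgraphs:
`H.graph ↪g G.graph` is an isomorphism of `H` onto an induced subgraph of `G`. -/
def IsHereditary (𝒢 : Set FinGraph) : Prop :=
  ∀ G ∈ 𝒢, ∀ H : FinGraph, Nonempty (H.graph ↪g G.graph) → H ∈ 𝒢

/-- The graph-intersection of two classes: all graphs `G₁ ∩ G₂` with `Gᵢ` in the `i`-th class.
Both graphs are taken on the vertex set of the intersection, which for hereditary classes is no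
restriction. -/
def graphIntersection (𝒢₁ 𝒢₂ : Set FinGraph) : Set FinGraph :=
  {G | ∃ G₁ G₂ : SimpleGraph G.V,
    FinGraph.mk G.V G₁ ∈ 𝒢₁ ∧ FinGraph.mk G.V G₂ ∈ 𝒢₂ ∧ G.graph = G₁ ⊓ G₂}

/-- Trivially perfect graphs: in every (non-null) induced subgraph, the independence number equals
the number of maximal cliques. -/
def triviallyPerfectGraphs : Set FinGraph :=
  {G | ∀ s : Set G.V, s.Nonempty →
    (G.graph.induce s).indepNum = {c : Set s | Maximal (G.graph.induce s).IsClique c}.ncard}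

/-- No induced cycle of length at least four. -/
def IsChordal {V : Type} (G : SimpleGraph V) : Prop :=
  ∀ n : ℕ, 4 ≤ n → IsEmpty (SimpleGraph.cycleGraph n ↪g G)

/-- Strongly chordal graphs: chordal graphs in which every cycle `v₀, …, v₂ₗ₋₁` with `l ≥ 3` has an
odd chord, i.e. an edge `vᵢvⱼ` of the graph that is not an edge of the cycle and whose indices
have different parity. -/
def stronglyChordalGraphs : Set FinGraph :=
  {G | IsChordal G.graph ∧
    ∀ l : ℕ, 3 ≤ l → ∀ v : SimpleGraph.Copy (SimpleGraph.cycleGraph (2 * l)) G.graph,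
      ∃ i j : Fin (2 * l), G.graph.Adj (v i) (v j) ∧
        ¬ (SimpleGraph.cycleGraph (2 * l)).Adj i j ∧ i.val % 2 ≠ j.val % 2}

/-! ### The Burling sequence

The families of boxes `𝓑 k` in `ℝ³` are built together with families of probes. A probe is a
rectangle `R` in the `yz`-plane; the boxes that the column `ℝ × R` meets are pairwise disjoint.
The next family consists of

* one translated copy of the current family;
* for each probe `P`, a small copy of the current family, inside the column of `P` and next to
  the translated copy;
* for each pair of probes `P, Q`, one box that meets exactly those boxes of the small copy in `P`
  which the copy of `Q` inside `P` meets.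

Each pair `P, Q` gives rise to two new probes: one meets the boxes of the translated copy that `P`
meets and the boxes of the small copy in `P` that `Q` meets, the other one meets the boxes of the
translated copy that `P` meets and the new box of the pair. -/

namespace Burling

/-- Index set of the probes; the family numbered `k` here is the `(k+1)`-st of the sequence. -/
def ProbeIdx : ℕ → Type
  | 0 => Unit
  | k + 1 => ProbeIdx k × ProbeIdx k × Bool

/-- Index set of the boxes. -/
def BoxIdx : ℕ → Type
  | 0 => Unit
  | k + 1 => BoxIdx k ⊕ (ProbeIdx k × BoxIdx k) ⊕ (ProbeIdx k × ProbeIdx k)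

/-- The rectangle `[y₀, y₁] × [z₀, z₁]`. -/
@[ext] structure Rect where
  (y₀ y₁ z₀ z₁ : ℝ)

/-- The box `[x₀, x₁] × [y₀, y₁] × [z₀, z₁]`. -/
@[ext] structure Box extends Rect where
  (x₀ x₁ : ℝ)

/-- The axis-parallel box as a subset of `ℝ³`. -/
def Box.toSet (b : Box) : Set (ℝ × ℝ × ℝ) :=
  Set.Icc b.x₀ b.x₁ ×ˢ Set.Icc b.y₀ b.y₁ ×ˢ Set.Icc b.z₀ b.z₁

/-- The image of `R` under the affine map that sends the unit square onto the lower half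
`[P.y₀, P.y₁] × [P.z₀, (P.z₀ + P.z₁) / 2]` of `P`. -/
noncomputable def Rect.placeIn (P R : Rect) : Rect where
  y₀ := P.y₀ + (P.y₁ - P.y₀) * R.y₀
  y₁ := P.y₀ + (P.y₁ - P.y₀) * R.y₁
  z₀ := P.z₀ + (P.z₁ - P.z₀) / 2 * R.z₀
  z₁ := P.z₀ + (P.z₁ - P.z₀) / 2 * R.z₁

/-- All boxes of the family `k` lie in `[0, width k] × [0, 1] × [0, 1]`. -/
def width : ℕ → ℝ
  | 0 => 1
  | k + 1 => 2 * width k + 1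

/-- The probes. -/
noncomputable def probe : (k : ℕ) → ProbeIdx k → Rect
  | 0, _ => ⟨0, 1, 0, 1⟩
  | k + 1, (P, Q, false) =>
      let p := probe k P
      let q := p.placeIn (probe k Q)
      ⟨q.y₁ - (q.y₁ - q.y₀) / 3, q.y₁, q.z₀, q.z₁⟩
  | k + 1, (P, Q, true) =>
      let p := probe k P
      let q := p.placeIn (probe k Q)
      ⟨q.y₀, q.y₀ + (q.y₁ - q.y₀) / 3, p.z₁ - (p.z₁ - p.z₀) / 4, p.z₁⟩

/-- The boxes. -/
noncomputable def box : (k : ℕ) → BoxIdx k → Box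
  | 0, _ => ⟨⟨0, 1, 0, 1⟩, 0, 1⟩
  | k + 1, .inl v =>
      ⟨(box k v).toRect, (box k v).x₀ + (width k + 1), (box k v).x₁ + (width k + 1)⟩
  | k + 1, .inr (.inl (P, v)) =>
      ⟨(probe k P).placeIn (box k v).toRect, (box k v).x₀, (box k v).x₁⟩
  | k + 1, .inr (.inr (P, Q)) =>
      let p := probe k P
      let q := p.placeIn (probe k Q)
      ⟨⟨q.y₀, q.y₀ + (q.y₁ - q.y₀) / 3, q.z₁, p.z₁⟩, 0, width k⟩

end Burling

/-- The intersection graph of an indexed family of sets. -/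
def intersectionGraph {ι α : Type*} (A : ι → Set α) : SimpleGraph ι where
  Adj i j := i ≠ j ∧ (A i ∩ A j).Nonempty
  symm := ⟨fun _ _ h => ⟨h.1.symm, Set.inter_comm _ _ ▸ h.2⟩⟩
  loopless := ⟨fun _ h => h.1 rfl⟩

/-- The Burling sequence, starting with `burlingSequence 0`, the one-vertex graph. -/
def burlingSequence (k : ℕ) : SimpleGraph (Burling.BoxIdx k) :=
  intersectionGraph fun v => (Burling.box k v).toSet

/-- Burling graphs: the graphs isomorphic to an induced subgraph of a graph of the Burling
sequence. -/
def burlingGraphs : Set FinGraph :=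
  {G | ∃ k : ℕ, Nonempty (G.graph ↪g burlingSequence k)}

/-! ### The combinatorial description of the Burling sequence

The definition of the boxes is checked here against the usual abstract construction: from a graph
with a family of stable sets, take a copy `G` of it; for each stable set `P`, take a further copy
`G_P`; for each stable set `Q` of `G_P`, add a vertex adjacent to exactly the vertices of `Q`; the
new stable sets are `P ∪ Q` and `P` with the added vertex. -/

namespace Burling

/-- Abstract description of the stable sets of the Burling sequence: `Stabs k P v` says that the
vertex `v` belongs to the stable set `P`. -/
def Stabs : (k : ℕ) → ProbeIdx k → BoxIdx k → Prop
  | 0, _, _ => True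
  | k + 1, (P, _, _), .inl v => Stabs k P v
  | k + 1, (P, Q, b), .inr (.inl (P', v)) => b = false ∧ P' = P ∧ Stabs k Q v
  | _ + 1, (P, Q, b), .inr (.inr (P', Q')) => b = true ∧ P' = P ∧ Q' = Q

/-- Abstract description of the edges of the Burling sequence. -/
def AbstractAdj : (k : ℕ) → BoxIdx k → BoxIdx k → Prop
  | 0, _, _ => False
  | k + 1, .inl u, .inl v => AbstractAdj k u v
  | k + 1, .inr (.inl (P, u)), .inr (.inl (P', v)) => P = P' ∧ AbstractAdj k u v
  | k + 1, .inr (.inl (P, u)), .inr (.inr (P', Q)) => P = P' ∧ Stabs k Q u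
  | k + 1, .inr (.inr (P', Q)), .inr (.inl (P, u)) => P = P' ∧ Stabs k Q u
  | _ + 1, _, _ => False

theorem toSet_inter_nonempty {a b : Box} (ha : a.x₀ ≤ a.x₁ ∧ a.y₀ ≤ a.y₁ ∧ a.z₀ ≤ a.z₁)
    (hb : b.x₀ ≤ b.x₁ ∧ b.y₀ ≤ b.y₁ ∧ b.z₀ ≤ b.z₁) :
    (a.toSet ∩ b.toSet).Nonempty ↔ (a.x₀ ≤ b.x₁ ∧ b.x₀ ≤ a.x₁) ∧
      (a.y₀ ≤ b.y₁ ∧ b.y₀ ≤ a.y₁) ∧ (a.z₀ ≤ b.z₁ ∧ b.z₀ ≤ a.z₁) := by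
  simp only [Box.toSet, Set.prod_inter_prod, Set.prod_nonempty_iff, Set.Icc_inter_Icc,
    Set.nonempty_Icc, sup_le_iff, le_inf_iff]
  tauto

theorem width_pos (k : ℕ) : 0 < width k := by
  induction k with
  | zero => simp [width]
  | succ k ih => simp only [width]; linarith

theorem probe_bounds (k : ℕ) (P : ProbeIdx k) :
    0 ≤ (probe k P).y₀ ∧ (probe k P).y₀ < (probe k P).y₁ ∧ (probe k P).y₁ ≤ 1 ∧
    0 ≤ (probe k P).z₀ ∧ (probe k P).z₀ < (probe k P).z₁ ∧ (probe k P).z₁ ≤ 1 := by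
  induction k with
  | zero => simp [probe]
  | succ k ih =>
    obtain ⟨P, Q, b⟩ := P
    obtain ⟨p1, p2, p3, p4, p5, p6⟩ := ih P
    obtain ⟨q1, q2, q3, q4, q5, q6⟩ := ih Q
    cases b <;> simp only [probe, Rect.placeIn] <;>
    generalize probe k P = p at * <;> generalize probe k Q = q at * <;>
    refine ⟨?_, ?_, ?_, ?_, ?_, ?_⟩ <;> nlinarith [mul_nonneg (sub_pos.2 p2).le q1,
      mul_nonneg (sub_pos.2 p5).le q4, mul_pos (sub_pos.2 p2) (sub_pos.2 q2),
      mul_pos (sub_pos.2 p5) (sub_pos.2 q5), mul_nonneg (sub_pos.2 p2).le (sub_nonneg.2 q3),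
      mul_nonneg (sub_pos.2 p5).le (sub_nonneg.2 q6)]

theorem placeIn_le {p : Rect} (hy : p.y₀ < p.y₁) (hz : p.z₀ < p.z₁) (a b : ℝ) :
    (p.y₀ + (p.y₁ - p.y₀) * a ≤ p.y₀ + (p.y₁ - p.y₀) * b ↔ a ≤ b) ∧
    (p.z₀ + (p.z₁ - p.z₀) / 2 * a ≤ p.z₀ + (p.z₁ - p.z₀) / 2 * b ↔ a ≤ b) :=
  ⟨by rw [add_le_add_iff_left, mul_le_mul_iff_right₀ (by linarith)],
    by rw [add_le_add_iff_left, mul_le_mul_iff_right₀ (by linarith)]⟩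

/-- A rectangle in the unit square is placed into the lower half of `p`. -/
theorem placeIn_bounds {p : Rect} (hy : p.y₀ < p.y₁) (hz : p.z₀ < p.z₁) (a : ℝ) (h0 : 0 ≤ a)
    (h1 : a ≤ 1) : p.y₀ ≤ p.y₀ + (p.y₁ - p.y₀) * a ∧ p.y₀ + (p.y₁ - p.y₀) * a ≤ p.y₁ ∧
    p.z₀ ≤ p.z₀ + (p.z₁ - p.z₀) / 2 * a ∧
    p.z₀ + (p.z₁ - p.z₀) / 2 * a ≤ p.z₁ - (p.z₁ - p.z₀) / 2 := by
  refine ⟨?_, ?_, ?_, ?_⟩ <;> nlinarith [mul_nonneg (sub_pos.2 hy).le h0,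
    mul_nonneg (sub_pos.2 hz).le h0, mul_nonneg (sub_pos.2 hy).le (sub_nonneg.2 h1),
    mul_nonneg (sub_pos.2 hz).le (sub_nonneg.2 h1)]

theorem box_bounds (k : ℕ) (v : BoxIdx k) :
    (0 ≤ (box k v).x₀ ∧ (box k v).x₀ ≤ (box k v).x₁ ∧ (box k v).x₁ ≤ width k) ∧
    (0 ≤ (box k v).y₀ ∧ (box k v).y₀ ≤ (box k v).y₁ ∧ (box k v).y₁ ≤ 1) ∧
    (0 ≤ (box k v).z₀ ∧ (box k v).z₀ ≤ (box k v).z₁ ∧ (box k v).z₁ ≤ 1) := by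
  induction k with
  | zero => simp [box, width]
  | succ k ih =>
    have hw := width_pos k
    rcases v with v | ⟨P, v⟩ | ⟨P, Q⟩
    · have := ih v
      simp only [box, width]
      refine ⟨⟨?_, ?_, ?_⟩, this.2⟩ <;> linarith [this.1.1, this.1.2.1, this.1.2.2]
    · obtain ⟨⟨a1, a2, a3⟩, ⟨a4, a5, a6⟩, a7, a8, a9⟩ := ih v
      obtain ⟨p1, p2, p3, p4, p5, p6⟩ := probe_bounds k P
      have h0 := placeIn_bounds p2 p5 _ a4 (a5.trans a6)
      have h1 := placeIn_bounds p2 p5 _ (a4.trans a5) a6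
      have h2 := placeIn_bounds p2 p5 _ a7 (a8.trans a9)
      have h3 := placeIn_bounds p2 p5 _ (a7.trans a8) a9
      simp only [box, width, Rect.placeIn, (placeIn_le p2 p5 _ _).1, (placeIn_le p2 p5 _ _).2]
      refine ⟨⟨a1, a2, ?_⟩, ⟨?_, a5, ?_⟩, ?_, a8, ?_⟩ <;> linarith
    · obtain ⟨p1, p2, p3, p4, p5, p6⟩ := probe_bounds k P
      obtain ⟨q1, q2, q3, q4, q5, q6⟩ := probe_bounds k Q
      have h0 := placeIn_bounds p2 p5 _ q1 (q2.le.trans q3)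
      have h1 := placeIn_bounds p2 p5 _ (q1.trans q2.le) q3
      have h3 := placeIn_bounds p2 p5 _ (q4.trans q5.le) q6
      have h4 := (placeIn_le p2 p5 _ _).1.2 q2.le
      simp only [box, width, Rect.placeIn]
      refine ⟨⟨le_rfl, ?_, ?_⟩, ⟨?_, ?_, ?_⟩, ?_, ?_, ?_⟩ <;> linarith

/-- The `y`-projections of two distinct probes are disjoint. -/
theorem probe_disjoint (k : ℕ) (R R' : ProbeIdx k) (h : R ≠ R') :
    (probe k R).y₁ < (probe k R').y₀ ∨ (probe k R').y₁ < (probe k R).y₀ := by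
  induction k with
  | zero => exact absurd (Subsingleton.elim (α := Unit) R R') h
  | succ k ih =>
    obtain ⟨P, Q, b⟩ := R
    obtain ⟨P', Q', b'⟩ := R'
    obtain ⟨p1, p2, p3, p4, p5, p6⟩ := probe_bounds k P
    obtain ⟨q1, q2, q3, q4, q5, q6⟩ := probe_bounds k Q
    obtain ⟨p1', p2', p3', p4', p5', p6'⟩ := probe_bounds k P'
    obtain ⟨q1', q2', q3', q4', q5', q6'⟩ := probe_bounds k Q'
    have h0 := placeIn_bounds p2 p5 _ q1 (q2.le.trans q3)
    have h1 := placeIn_bounds p2 p5 _ (q1.trans q2.le) q3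
    have h0' := placeIn_bounds p2' p5' _ q1' (q2'.le.trans q3')
    have h1' := placeIn_bounds p2' p5' _ (q1'.trans q2'.le) q3'
    have h4 := lt_of_not_ge (mt (placeIn_le p2 p5 _ _).1.1 q2.not_ge)
    have h4' := lt_of_not_ge (mt (placeIn_le p2' p5' _ _).1.1 q2'.not_ge)
    by_cases hP : P = P'
    · subst hP
      by_cases hQ : Q = Q'
      · subst hQ
        cases b <;> cases b' <;> simp only [probe, Rect.placeIn] <;>
          first | exact absurd rfl h | (left; linarith) | (right; linarith)
      · rcases ih Q Q' hQ with h5 | h5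
        · have h6 := lt_of_not_ge (mt (placeIn_le p2 p5 _ _).1.1 h5.not_ge)
          left; cases b <;> cases b' <;> simp only [probe, Rect.placeIn] <;> linarith
        · have h6 := lt_of_not_ge (mt (placeIn_le p2 p5 _ _).1.1 h5.not_ge)
          right; cases b <;> cases b' <;> simp only [probe, Rect.placeIn] <;> linarith
    · rcases ih P P' hP with h5 | h5
      · left; cases b <;> cases b' <;> simp only [probe, Rect.placeIn] <;> linarith
      · right; cases b <;> cases b' <;> simp only [probe, Rect.placeIn] <;> linarith

/-- A box in the stable set of a probe covers the probe, every other box misses the region of the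
column above the bottom of the probe. -/
theorem stabs_iff (k : ℕ) (P : ProbeIdx k) (v : BoxIdx k) :
    (Stabs k P v ∧ ((box k v).y₀ ≤ (probe k P).y₀ ∧ (probe k P).y₁ ≤ (box k v).y₁ ∧
      (box k v).z₀ ≤ (probe k P).z₀ ∧ (probe k P).z₁ ≤ (box k v).z₁)) ∨
    (¬ Stabs k P v ∧ ((box k v).y₁ < (probe k P).y₀ ∨ (probe k P).y₁ < (box k v).y₀ ∨
      (box k v).z₁ < (probe k P).z₀)) := by
  induction k with
  | zero => left; simp [Stabs, box, probe]
  | succ k ih =>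
    obtain ⟨P, Q, b⟩ := P
    obtain ⟨p1, p2, p3, p4, p5, p6⟩ := probe_bounds k P
    obtain ⟨q1, q2, q3, q4, q5, q6⟩ := probe_bounds k Q
    have h0 := placeIn_bounds p2 p5 _ q1 (q2.le.trans q3)
    have h1 := placeIn_bounds p2 p5 _ (q1.trans q2.le) q3
    have h2 := placeIn_bounds p2 p5 _ q4 (q5.le.trans q6)
    have h3 := placeIn_bounds p2 p5 _ (q4.trans q5.le) q6
    have h4 := lt_of_not_ge (mt (placeIn_le p2 p5 _ _).1.1 q2.not_ge)
    have h5 := lt_of_not_ge (mt (placeIn_le p2 p5 _ _).2.1 q5.not_ge)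
    rcases v with v | ⟨P', v⟩ | ⟨P', Q'⟩
    · rcases ih P v with ⟨h, e1, e2, e3, e4⟩ | ⟨h, e⟩
      · left
        refine ⟨h, ?_⟩
        cases b <;> simp only [probe, box, Rect.placeIn] <;>
          refine ⟨?_, ?_, ?_, ?_⟩ <;> linarith
      · right
        refine ⟨h, ?_⟩
        cases b <;> simp only [probe, box, Rect.placeIn] <;>
          exact e.imp (fun e => by linarith) (Or.imp (fun e => by linarith) (fun e => by linarith))
    · obtain ⟨p1', p2', p3', p4', p5', p6'⟩ := probe_bounds k P'
      obtain ⟨-, ⟨a4, a5, a6⟩, a7, a8, a9⟩ := box_bounds k v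
      have g0 := placeIn_bounds p2' p5' _ a4 (a5.trans a6)
      have g1 := placeIn_bounds p2' p5' _ (a4.trans a5) a6
      have g2 := placeIn_bounds p2' p5' _ a7 (a8.trans a9)
      have g3 := placeIn_bounds p2' p5' _ (a7.trans a8) a9
      by_cases hP : P' = P
      · subst hP
        cases b with
        | true =>
          right
          refine ⟨fun h => by simpa using h.1, .inr (.inr ?_)⟩
          simp only [probe, box, Rect.placeIn]
          linarith
        | false =>
          rcases ih Q v with ⟨h, e1, e2, e3, e4⟩ | ⟨h, e⟩
          · left
            refine ⟨⟨rfl, rfl, h⟩, ?_⟩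
            have f1 := (placeIn_le p2 p5 _ _).1.2 e1
            have f2 := (placeIn_le p2 p5 _ _).1.2 e2
            simp only [probe, box, Rect.placeIn, (placeIn_le p2 p5 _ _).2]
            exact ⟨by linarith, f2 |>.trans' (by linarith), e3, e4⟩
          · right
            refine ⟨fun h' => h h'.2.2, ?_⟩
            simp only [probe, box, Rect.placeIn]
            rcases e with e | e | e
            · have f := lt_of_not_ge (mt (placeIn_le p2 p5 _ _).1.1 e.not_ge)
              left; linarith
            · have f := lt_of_not_ge (mt (placeIn_le p2 p5 _ _).1.1 e.not_ge)
              right; left; linarith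
            · have f := lt_of_not_ge (mt (placeIn_le p2 p5 _ _).2.1 e.not_ge)
              right; right; linarith
      · right
        refine ⟨fun h => hP h.2.1, ?_⟩
        rcases probe_disjoint k P' P hP with h | h
        · left; cases b <;> simp only [probe, box, Rect.placeIn] <;> linarith
        · right; left; cases b <;> simp only [probe, box, Rect.placeIn] <;> linarith
    · obtain ⟨p1', p2', p3', p4', p5', p6'⟩ := probe_bounds k P'
      obtain ⟨q1', q2', q3', q4', q5', q6'⟩ := probe_bounds k Q'
      have g0 := placeIn_bounds p2' p5' _ q1' (q2'.le.trans q3')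
      have g1 := placeIn_bounds p2' p5' _ (q1'.trans q2'.le) q3'
      have g4 := lt_of_not_ge (mt (placeIn_le p2' p5' _ _).1.1 q2'.not_ge)
      by_cases hP : P' = P
      · subst hP
        by_cases hQ : Q' = Q
        · subst hQ
          cases b with
          | true =>
            left
            refine ⟨⟨rfl, rfl, rfl⟩, ?_⟩
            simp only [probe, box, Rect.placeIn]
            refine ⟨le_rfl, le_rfl, ?_, le_rfl⟩
            linarith
          | false =>
            right
            refine ⟨fun h => by simpa using h.1, .inl ?_⟩
            simp only [probe, box, Rect.placeIn]
            linarith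
        · right
          refine ⟨fun h => hQ h.2.2, ?_⟩
          rcases probe_disjoint k Q' Q hQ with h | h
          · have f := lt_of_not_ge (mt (placeIn_le p2 p5 _ _).1.1 h.not_ge)
            left; cases b <;> simp only [probe, box, Rect.placeIn] <;> linarith
          · have f := lt_of_not_ge (mt (placeIn_le p2 p5 _ _).1.1 h.not_ge)
            right; left; cases b <;> simp only [probe, box, Rect.placeIn] <;> linarith
      · right
        refine ⟨fun h => hP h.2.1, ?_⟩
        rcases probe_disjoint k P' P hP with h | h
        · left; cases b <;> simp only [probe, box, Rect.placeIn] <;> linarith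
        · right; left; cases b <;> simp only [probe, box, Rect.placeIn] <;> linarith

/-- The graphs of the Burling sequence are the graphs with edge relation `AbstractAdj`. -/
theorem toSet_inter_nonempty_iff (k : ℕ) (u v : BoxIdx k) (huv : u ≠ v) :
    ((box k u).toSet ∩ (box k v).toSet).Nonempty ↔ AbstractAdj k u v := by
  have bd (k : ℕ) (v : BoxIdx k) : (box k v).x₀ ≤ (box k v).x₁ ∧ (box k v).y₀ ≤ (box k v).y₁ ∧
      (box k v).z₀ ≤ (box k v).z₁ :=
    ⟨(box_bounds k v).1.2.1, (box_bounds k v).2.1.2.1, (box_bounds k v).2.2.2.1⟩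
  rw [toSet_inter_nonempty (bd k u) (bd k v)]
  induction k with
  | zero => exact absurd (Subsingleton.elim (α := Unit) u v) huv
  | succ k ih =>
    have key (P : ProbeIdx k) (u : BoxIdx k) (P' Q : ProbeIdx k) :
        ((box k u).x₀ ≤ width k ∧ 0 ≤ (box k u).x₁) ∧
        (((probe k P).placeIn (box k u).toRect).y₀ ≤ (box (k + 1) (.inr (.inr (P', Q)))).y₁ ∧
          (box (k + 1) (.inr (.inr (P', Q)))).y₀ ≤ ((probe k P).placeIn (box k u).toRect).y₁) ∧
        (((probe k P).placeIn (box k u).toRect).z₀ ≤ (box (k + 1) (.inr (.inr (P', Q)))).z₁ ∧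
          (box (k + 1) (.inr (.inr (P', Q)))).z₀ ≤ ((probe k P).placeIn (box k u).toRect).z₁) ↔
        P = P' ∧ Stabs k Q u := by
      obtain ⟨⟨a1, a2, a3⟩, ⟨a4, a5, a6⟩, a7, a8, a9⟩ := box_bounds k u
      obtain ⟨p1, p2, p3, p4, p5, p6⟩ := probe_bounds k P
      obtain ⟨p1', p2', p3', p4', p5', p6'⟩ := probe_bounds k P'
      obtain ⟨q1, q2, q3, q4, q5, q6⟩ := probe_bounds k Q
      have g0 := placeIn_bounds p2 p5 _ a4 (a5.trans a6)
      have g1 := placeIn_bounds p2 p5 _ (a4.trans a5) a6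
      have g2 := placeIn_bounds p2 p5 _ a7 (a8.trans a9)
      have h0 := placeIn_bounds p2' p5' _ q1 (q2.le.trans q3)
      have h1 := placeIn_bounds p2' p5' _ (q1.trans q2.le) q3
      have h3 := placeIn_bounds p2' p5' _ (q4.trans q5.le) q6
      have h4 := lt_of_not_ge (mt (placeIn_le p2' p5' _ _).1.1 q2.not_ge)
      simp only [box, Rect.placeIn]
      by_cases hP : P = P'
      · subst hP
        rcases stabs_iff k Q u with ⟨h, e1, e2, e3, e4⟩ | ⟨h, e⟩
        · have f1 := (placeIn_le p2 p5 _ _).1.2 e1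
          have f2 := (placeIn_le p2 p5 _ _).1.2 e2
          have f4 := (placeIn_le p2 p5 _ _).2.2 e4
          simp only [h, and_self, iff_true]
          refine ⟨⟨?_, ?_⟩, ⟨?_, ?_⟩, ?_, ?_⟩ <;> linarith
        · simp only [h, and_false, iff_false]
          rintro ⟨-, ⟨c1, c2⟩, c3, c4⟩
          rcases e with e | e | e
          · have f := lt_of_not_ge (mt (placeIn_le p2 p5 _ _).1.1 e.not_ge)
            linarith
          · have f := lt_of_not_ge (mt (placeIn_le p2 p5 _ _).1.1 e.not_ge)
            linarith
          · have f := lt_of_not_ge (mt (placeIn_le p2 p5 _ _).2.1 e.not_ge)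
            have := lt_of_not_ge (mt (placeIn_le p2 p5 _ _).2.1 q5.not_ge)
            linarith
      · simp only [hP, false_and, iff_false]
        rintro ⟨-, ⟨c1, c2⟩, -⟩
        rcases probe_disjoint k P P' hP with h | h <;> linarith
    rcases u with u | ⟨P, u⟩ | ⟨P, Q⟩ <;> rcases v with v | ⟨P', v⟩ | ⟨P', Q'⟩
    · have := ih u v (fun h => huv (by rw [h]))
      simp only [AbstractAdj, ← this, box, add_le_add_iff_right]
    · simp only [AbstractAdj, iff_false, box]
      rintro ⟨h, -⟩
      linarith [(box_bounds k u).1.1, (box_bounds k v).1.2.2]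
    · simp only [AbstractAdj, iff_false, box]
      rintro ⟨h, -⟩
      linarith [(box_bounds k u).1.1]
    · simp only [AbstractAdj, iff_false, box]
      rintro ⟨h, -⟩
      linarith [(box_bounds k v).1.1, (box_bounds k u).1.2.2]
    · obtain ⟨p1, p2, p3, p4, p5, p6⟩ := probe_bounds k P
      by_cases hP : P = P'
      · subst hP
        have := ih u v (fun h => huv (by rw [h]))
        simp only [AbstractAdj, ← this, box, Rect.placeIn, (placeIn_le p2 p5 _ _).1,
          (placeIn_le p2 p5 _ _).2, true_and]
      · simp only [AbstractAdj, hP, false_and, iff_false, box, Rect.placeIn]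
        rintro ⟨-, h, -⟩
        obtain ⟨-, ⟨a4, a5, a6⟩, -⟩ := box_bounds k u
        obtain ⟨-, ⟨b4, b5, b6⟩, -⟩ := box_bounds k v
        obtain ⟨p1', p2', p3', p4', p5', p6'⟩ := probe_bounds k P'
        have g0 := placeIn_bounds p2 p5 _ a4 (a5.trans a6)
        have g1 := placeIn_bounds p2 p5 _ (a4.trans a5) a6
        have h0 := placeIn_bounds p2' p5' _ b4 (b5.trans b6)
        have h1 := placeIn_bounds p2' p5' _ (b4.trans b5) b6
        rcases probe_disjoint k P P' hP with h | h <;> linarith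
    · exact key P u P' Q'
    · simp only [AbstractAdj, iff_false, box]
      rintro ⟨h, -⟩
      linarith [(box_bounds k v).1.1]
    · rw [AbstractAdj, ← key P' v P Q]
      simp only [box]
      tauto
    · simp only [AbstractAdj, iff_false, box, Rect.placeIn]
      rintro ⟨-, h, -⟩
      obtain ⟨p1, p2, p3, p4, p5, p6⟩ := probe_bounds k P
      obtain ⟨q1, q2, q3, q4, q5, q6⟩ := probe_bounds k Q
      obtain ⟨p1', p2', p3', p4', p5', p6'⟩ := probe_bounds k P'
      obtain ⟨q1', q2', q3', q4', q5', q6'⟩ := probe_bounds k Q'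
      have h0 := placeIn_bounds p2 p5 _ q1 (q2.le.trans q3)
      have h1 := placeIn_bounds p2 p5 _ (q1.trans q2.le) q3
      have h0' := placeIn_bounds p2' p5' _ q1' (q2'.le.trans q3')
      have h1' := placeIn_bounds p2' p5' _ (q1'.trans q2'.le) q3'
      have h4 := lt_of_not_ge (mt (placeIn_le p2 p5 _ _).1.1 q2.not_ge)
      have h4' := lt_of_not_ge (mt (placeIn_le p2' p5' _ _).1.1 q2'.not_ge)
      by_cases hP : P = P'
      · subst hP
        have hQ : Q ≠ Q' := fun h => huv (by rw [h])
        rcases probe_disjoint k Q Q' hQ with e | e <;>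
        · have f := lt_of_not_ge (mt (placeIn_le p2 p5 _ _).1.1 e.not_ge)
          linarith
      · rcases probe_disjoint k P P' hP with h | h <;> linarith

theorem burlingSequence_adj (k : ℕ) (u v : BoxIdx k) :
    (burlingSequence k).Adj u v ↔ u ≠ v ∧ AbstractAdj k u v :=
  and_congr_right fun h => toSet_inter_nonempty_iff k u v h

end Burling

/-! ### Burling trees -/

/-- A rooted tree. -/
structure TreeWithRoot (V : Type) where
  tree : SimpleGraph V
  isTree : tree.IsTree
  root : V

namespace TreeWithRoot

variable {V : Type} (T : TreeWithRoot V)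

/-- `u` lies on the path from `v` to the root. -/
def IsAncestor (u v : V) : Prop := ∃ p : T.tree.Walk v T.root, p.IsPath ∧ u ∈ p.support

/-- `u` is the parent of `v` (and `v` a child of `u`): the neighbor of `v` on the path from `v` to
the root. -/
def IsParent (u v : V) : Prop := T.tree.Adj u v ∧ T.IsAncestor u v

/-- A leaf of a rooted tree is a vertex without children. -/
def IsLeaf (v : V) : Prop := ∀ w, ¬ T.IsParent v w

/-- A (possibly empty) branch, as the list of its vertices. -/
def IsBranch (B : List V) : Prop := B.IsChain T.IsParent

/-- A branch that starts at the root and ends at a leaf. -/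
def IsPrincipalBranch (B : List V) : Prop :=
  T.IsBranch B ∧ B.head? = some T.root ∧ ∃ v, B.getLast? = some v ∧ T.IsLeaf v

end TreeWithRoot

/-- Burling trees. The value of `lastBorn` at leaves is irrelevant. -/
structure BurlingTree (V : Type) extends TreeWithRoot V where
  /-- the last-born child of a non-leaf vertex -/
  lastBorn : V → V
  isParent_lastBorn : ∀ u, ¬ toTreeWithRoot.IsLeaf u → toTreeWithRoot.IsParent u (lastBorn u)
  /-- the choose function -/
  choose : V → Set V
  /-- for a vertex `v` with parent `u` that is not last-born, `choose v` is the vertex set of an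
  empty branch or of a branch starting at the last-born of `u` -/
  choose_of_ne_lastBorn : ∀ u v, toTreeWithRoot.IsParent u v → v ≠ lastBorn u →
    ∃ B : List V, toTreeWithRoot.IsBranch B ∧ (B = [] ∨ B.head? = some (lastBorn u)) ∧
      choose v = {w | w ∈ B}
  choose_lastBorn : ∀ u, ¬ toTreeWithRoot.IsLeaf u → choose (lastBorn u) = ∅
  choose_root : choose root = ∅

namespace BurlingTree

variable {V : Type} (T : BurlingTree V)

/-- The graph fully derived from `T`, underlying the oriented graph with an arc from `u` to each
vertex of `choose u`. -/
def derivedGraph : SimpleGraph V := SimpleGraph.fromRel fun u v => v ∈ T.choose u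

/-- The graph obtained from the derived graph by making every principal branch a clique. -/
def chordalGraph : SimpleGraph V :=
  T.derivedGraph ⊔ SimpleGraph.fromRel fun u v => ∃ B, T.IsPrincipalBranch B ∧ u ∈ B ∧ v ∈ B

end BurlingTree

/-- Burling strongly chordal graphs: the closure under induced subgraphs (and isomorphism) of the
class of the graphs `T.chordalGraph`, for `T` a finite Burling tree. -/
def burlingStronglyChordalGraphs : Set FinGraph :=
  {G | ∃ (V : Type) (_ : Finite V) (T : BurlingTree V), Nonempty (G.graph ↪g T.chordalGraph)}

/-! Closure under induced subgraphs holds because embeddings compose. The other claims rest on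
`chordalGraph_adj`: two distinct vertices of C(T) are adjacent exactly when one is an ancestor of
the other or one chooses the other.

Strong chordality follows once every nonempty vertex set `s` has a simple vertex
(`HasSimpleVertices`). By `exists_lowest_not_chosen` some `v` in `s` has no proper descendant in `s`
and is chosen by no member of `s`. Its neighbors in `s` are ancestors of `v` or lie on the branch
that `v` chooses. This branch starts at a child of the parent of `v`, so the ancestors of `v` all
lie above it, and the neighbors form a chain. Closed neighborhoods shrink along a chain
(`closedNeighborhood_anti`), so `v` is simple.

For properness, take the path on four vertices with each vertex replaced by a triangle. In a clique
of C(T) all vertices but at most one form an ancestor chain. Hence one vertex can be kept from each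
triangle such that consecutive ones are comparable in the tree, while the others are not; no forest
order allows this.

For Burling graphs, `burlingSequence_eq_derivedGraph` realizes each graph of the sequence as the
graph of the choose relation of a Burling tree. It differs from C(T) only by edges between ancestors
and descendants. These are removed by intersecting with the comparability graph of `Precedes`, a
forest order that contains the choose relation and relates no vertex to its ancestors or
descendants. Comparability graphs of forest orders are trivially perfect: their maximal cliques
correspond to the lowest vertices. -/

/-! ### The ancestor order of a rooted tree -/

namespace TreeWithRoot

variable {V : Type} (T : TreeWithRoot V)

/-- The reflexive transitive closure of the parent relation: `u` is `v` or an ancestor of `v`. -/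
def AncLE : V → V → Prop := Relation.ReflTransGen T.IsParent

variable {T}

/-- Paths in a tree are unique, so the initial piece from `v` to its neighbor `u` is the single
edge. Being a parent thus means being the second vertex of the path to the root. -/
theorem isParent_iff {u v : V} :
    T.IsParent u v ↔ ∃ (h : T.tree.Adj v u) (q : T.tree.Walk u T.root), (q.cons h).IsPath := by
  classical
  constructor
  · rintro ⟨h, p, hp, hu⟩
    have hs : (SimpleGraph.Walk.cons h.symm (.nil : T.tree.Walk u u)).IsPath := by
      simp [SimpleGraph.Walk.cons_isPath_iff, h.ne']
    have e := (T.isTree.existsUnique_path v u).unique (hp.takeUntil hu) hs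
    refine ⟨h.symm, p.dropUntil u hu, ?_⟩
    have e' := p.take_spec hu
    rw [e] at e'
    have hp' := hp
    rw [← e'] at hp'
    simpa using hp'
  · rintro ⟨h, q, hq⟩
    exact ⟨h.symm, _, hq, by simp⟩

theorem IsParent.unique {u u' v : V} (h : T.IsParent u v) (h' : T.IsParent u' v) : u = u' := by
  obtain ⟨h, q, hq⟩ := isParent_iff.1 h
  obtain ⟨h', q', hq'⟩ := isParent_iff.1 h'
  have := (T.isTree.existsUnique_path _ _).unique hq hq'
  simp only [SimpleGraph.Walk.cons.injEq] at this
  exact this.1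

/-- The depth is the length of the path to the root. Only its strict growth from parent to child is
used, as a measure for inductions and maximality arguments. -/
theorem exists_depth (T : TreeWithRoot V) :
    ∃ d : V → ℕ, ∀ u v, T.IsParent u v → d u < d v := by
  choose p hp hu using fun v => T.isTree.existsUnique_path v T.root
  refine ⟨fun v => (p v).length, fun u v h => ?_⟩
  obtain ⟨h, q, hq⟩ := isParent_iff.1 h
  have h1 := hu v _ hq
  have h2 := hu u q ((SimpleGraph.Walk.cons_isPath_iff _ _).1 hq).1
  simp only [← h1, ← h2, SimpleGraph.Walk.length_cons]
  omega

theorem exists_isParent {v : V} (hv : v ≠ T.root) : ∃ u, T.IsParent u v := by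
  obtain ⟨p, hp, -⟩ := T.isTree.existsUnique_path v T.root
  cases p with
  | nil => exact absurd rfl hv
  | cons h q => exact ⟨_, isParent_iff.2 ⟨h, q, hp⟩⟩

theorem IsParent.ancLE {u v : V} (h : T.IsParent u v) : T.AncLE u v := .single h

theorem AncLE.refl (u : V) : T.AncLE u u := Relation.ReflTransGen.refl

theorem AncLE.trans {u v w : V} (h : T.AncLE u v) (h' : T.AncLE v w) : T.AncLE u w :=
  Relation.ReflTransGen.trans h h'

theorem AncLE.antisymm {u v : V} (h : T.AncLE u v) (h' : T.AncLE v u) : u = v := by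
  obtain ⟨d, hd⟩ := T.exists_depth
  have key : ∀ u v, T.AncLE u v → u = v ∨ d u < d v := by
    intro u v h
    induction h with
    | refl => exact .inl rfl
    | tail _ h ih =>
      have := hd _ _ h
      rcases ih with rfl | ih <;> exact .inr (by omega)
  rcases key u v h with h | h1
  · exact h
  · rcases key v u h' with h | h2
    · exact h.symm
    · omega

theorem IsParent.not_ancLE {u v : V} (h : T.IsParent u v) : ¬ T.AncLE v u := fun h' => by
  have := h'.antisymm h.ancLE
  subst this
  exact h.1.ne rfl

/-- Every vertex other than `w` that is above `w` is above the parent of `w`. -/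
theorem AncLE.of_isParent {u p w : V} (h : T.AncLE u w) (hp : T.IsParent p w) (hne : u ≠ w) :
    T.AncLE u p := by
  rcases Relation.ReflTransGen.cases_tail h with h | ⟨x, h, hx⟩
  · exact absurd h.symm hne
  · rwa [hp.unique hx]

/-- The vertices above a given vertex form a chain. -/
theorem AncLE.total {u v w : V} (hu : T.AncLE u w) (hv : T.AncLE v w) :
    T.AncLE u v ∨ T.AncLE v u := by
  have := Relation.ReflTransGen.total_of_right_unique (r := Function.swap T.IsParent)
    (fun a b c hb hc => hb.unique hc) (a := w) (b := u) (c := v)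
    (Relation.reflTransGen_swap.2 hu) (Relation.reflTransGen_swap.2 hv)
  exact this.symm.imp Relation.reflTransGen_swap.1 Relation.reflTransGen_swap.1

theorem root_ancLE (v : V) : T.AncLE T.root v := by
  obtain ⟨d, hd⟩ := T.exists_depth
  induction h : d v using Nat.strong_induction_on generalizing v with
  | _ n ih =>
    by_cases hv : v = T.root
    · rw [hv]; exact .refl _
    · obtain ⟨u, hu⟩ := exists_isParent hv
      exact (ih (d u) (h ▸ hd _ _ hu) u rfl).trans hu.ancLE

/-- Children of the same vertex that have a common descendant are equal. -/
theorem IsParent.eq_of_ancLE {p u v w : V} (hu : T.IsParent p u) (hv : T.IsParent p v)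
    (huw : T.AncLE u w) (hvw : T.AncLE v w) : u = v := by
  by_contra hne
  rcases huw.total hvw with h | h
  · exact hu.not_ancLE (h.of_isParent hv hne)
  · exact hv.not_ancLE (h.of_isParent hu (Ne.symm hne))

/-! ### Branches as convex chains of the ancestor order. -/

theorem IsBranch.pairwise_ancLE {B : List V} (hB : T.IsBranch B) : B.Pairwise T.AncLE := by
  have : Trans T.AncLE T.AncLE T.AncLE := ⟨AncLE.trans⟩
  exact (List.IsChain.imp (fun _ _ h => IsParent.ancLE h) hB).pairwise

theorem IsBranch.ancLE_total {B : List V} (hB : T.IsBranch B) {u v : V} (hu : u ∈ B) (hv : v ∈ B) :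
    T.AncLE u v ∨ T.AncLE v u := by
  have hsymm : Std.Symm fun u v => T.AncLE u v ∨ T.AncLE v u := ⟨fun _ _ h => h.symm⟩
  exact List.Pairwise.forall_of_forall (R := fun u v => T.AncLE u v ∨ T.AncLE v u)
    (fun x _ => .inl (.refl x)) (hB.pairwise_ancLE.imp fun h => .inl h) hu hv

theorem IsBranch.head_ancLE {a : V} {B : List V} (hB : T.IsBranch B) (ha : B.head? = some a)
    {w : V} (hw : w ∈ B) : T.AncLE a w := by
  obtain ⟨B, rfl⟩ := List.head?_eq_some_iff.1 ha
  rcases List.mem_cons.1 hw with rfl | hw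
  · exact .refl _
  · exact (List.pairwise_cons.1 hB.pairwise_ancLE).1 w hw

theorem IsBranch.mem_of_isParent {a : V} {B : List V} (hB : T.IsBranch B)
    (ha : B.head? = some a) {w p : V} (hw : w ∈ B) (hp : T.IsParent p w) : w = a ∨ p ∈ B := by
  induction B generalizing a with
  | nil => simp at hw
  | cons b B ih =>
    simp only [List.head?_cons, Option.some.injEq] at ha
    subst ha
    cases B with
    | nil => left; simpa using hw
    | cons c B =>
      obtain ⟨h1, h2⟩ := List.isChain_cons_cons.1 hB
      rcases List.mem_cons.1 hw with rfl | hw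
      · exact .inl rfl
      · rcases ih h2 rfl hw with rfl | h
        · right; rw [hp.unique h1]; simp
        · exact .inr (List.mem_cons_of_mem _ h)

/-- A branch contains every vertex between its first vertex and any of its vertices. -/
theorem IsBranch.mem_of_ancLE {a : V} {B : List V} (hB : T.IsBranch B) (ha : B.head? = some a)
    {x w : V} (hw : w ∈ B) (hax : T.AncLE a x) (hxw : T.AncLE x w) : x ∈ B := by
  -- Climbing from `w`, one stays in `B` until the first vertex `a` is passed; the second
  -- alternative keeps the induction going beyond `a`.
  have key : x ∈ B ∨ T.AncLE x a := by
    induction hxw using Relation.ReflTransGen.head_induction_on with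
    | refl => exact .inl hw
    | @head y z h h' ih =>
      rcases ih (hax.trans h.ancLE) with hz | hz
      · rcases hB.mem_of_isParent ha hz h with rfl | hy
        · exact .inr h.ancLE
        · exact .inl hy
      · exact .inr (h.ancLE.trans hz)
  rcases key with h | h
  · exact h
  · obtain rfl := h.antisymm hax
    obtain ⟨B, rfl⟩ := List.head?_eq_some_iff.1 ha
    simp

/-- A descendant of `v` of maximal depth has no child. -/
theorem exists_isLeaf_ancLE [Finite V] (v : V) : ∃ w, T.IsLeaf w ∧ T.AncLE v w := by
  obtain ⟨d, hd⟩ := T.exists_depth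
  obtain ⟨w, hw, hmax⟩ := Set.exists_max_image {w | T.AncLE v w} d (Set.toFinite _) ⟨v, .refl v⟩
  refine ⟨w, fun x hx => ?_, hw⟩
  exact (hmax x (AncLE.trans hw hx.ancLE)).not_gt (hd _ _ hx)

/-- Two vertices lie on a common principal branch iff one of them is above the other one. -/
theorem exists_isPrincipalBranch_iff [Finite V] {u v : V} :
    (∃ B, T.IsPrincipalBranch B ∧ u ∈ B ∧ v ∈ B) ↔ T.AncLE u v ∨ T.AncLE v u := by
  constructor
  · rintro ⟨B, hB, hu, hv⟩
    exact hB.1.ancLE_total hu hv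
  · have key : ∀ u v, T.AncLE u v → ∃ B, T.IsPrincipalBranch B ∧ u ∈ B ∧ v ∈ B := by
      intro u v h
      obtain ⟨w, hw, hvw⟩ := T.exists_isLeaf_ancLE v
      obtain ⟨l, hl, hlast⟩ := List.exists_isChain_cons_of_relationReflTransGen (T.root_ancLE w)
      have hmem : w ∈ T.root :: l := hlast ▸ List.getLast_mem _
      have hB : T.IsBranch (T.root :: l) := hl
      refine ⟨T.root :: l, ⟨hB, rfl, w, ?_, hw⟩, ?_, ?_⟩
      · rw [List.getLast?_eq_getLast_of_ne_nil (List.cons_ne_nil _ _), hlast]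
      · exact hB.mem_of_ancLE rfl hmem (T.root_ancLE u) (h.trans hvw)
      · exact hB.mem_of_ancLE rfl hmem (T.root_ancLE v) hvw
    rintro (h | h)
    · exact key u v h
    · obtain ⟨B, h1, h2, h3⟩ := key v u h
      exact ⟨B, h1, h3, h2⟩

end TreeWithRoot

namespace BurlingTree

variable {V : Type} {T : BurlingTree V}

theorem isParent_lastBorn_of_isParent {q u : V} (h : T.IsParent q u) :
    T.IsParent q (T.lastBorn q) :=
  T.isParent_lastBorn q fun hl => hl u h

/-- The structure of a nonempty set of the choose function. -/
theorem exists_isParent_of_mem_choose {u w : V} (h : w ∈ T.choose u) :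
    ∃ q, T.IsParent q u ∧ u ≠ T.lastBorn q ∧ T.AncLE (T.lastBorn q) w ∧
      (∀ x, T.AncLE (T.lastBorn q) x → T.AncLE x w → x ∈ T.choose u) ∧
      ∀ x ∈ T.choose u, T.AncLE (T.lastBorn q) x ∧ (T.AncLE x w ∨ T.AncLE w x) := by
  have hr : u ≠ T.root := by
    rintro rfl
    simp [T.choose_root] at h
  obtain ⟨q, hq⟩ := TreeWithRoot.exists_isParent hr
  have hne : u ≠ T.lastBorn q := by
    rintro rfl
    simp [T.choose_lastBorn q (fun hl => hl _ hq)] at h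
  obtain ⟨B, hB, h0, hc⟩ := T.choose_of_ne_lastBorn q u hq hne
  rw [hc] at h
  have hhead : B.head? = some (T.lastBorn q) := by
    rcases h0 with rfl | h0
    · simp at h
    · exact h0
  refine ⟨q, hq, hne, hB.head_ancLE hhead h, fun x h1 h2 => ?_, fun x hx => ?_⟩
  · rw [hc]
    exact hB.mem_of_ancLE hhead h h1 h2
  · rw [hc] at hx
    exact ⟨hB.head_ancLE hhead hx, hB.ancLE_total hx h⟩

theorem chordalGraph_adj [Finite V] {u v : V} : T.chordalGraph.Adj u v ↔
    u ≠ v ∧ (v ∈ T.choose u ∨ u ∈ T.choose v ∨ T.AncLE u v ∨ T.AncLE v u) := by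
  simp only [chordalGraph, derivedGraph, SimpleGraph.sup_adj, SimpleGraph.fromRel_adj,
    TreeWithRoot.exists_isPrincipalBranch_iff]
  tauto

end BurlingTree

/-! ### Strongly chordal graphs from simple vertices -/

/-- Every nonempty set of vertices `s` contains a simple vertex of the subgraph induced by `s`, that
is, a vertex whose neighbors have closed neighborhoods linearly ordered by inclusion. -/
def HasSimpleVertices {V : Type} (G : SimpleGraph V) : Prop :=
  ∀ s : Set V, s.Nonempty → ∃ v ∈ s, ∀ x ∈ s, ∀ y ∈ s, G.Adj v x → G.Adj v y →
    (∀ z ∈ s, z = x ∨ G.Adj x z → z = y ∨ G.Adj y z) ∨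
    (∀ z ∈ s, z = y ∨ G.Adj y z → z = x ∨ G.Adj x z)

theorem HasSimpleVertices.comap {V W : Type} {G : SimpleGraph V} {H : SimpleGraph W}
    (hG : HasSimpleVertices G) (f : H ↪g G) : HasSimpleVertices H := by
  intro s hs
  obtain ⟨_, ⟨v, hv, rfl⟩, h⟩ := hG (f '' s) (hs.image f)
  refine ⟨v, hv, fun x hx y hy hvx hvy => ?_⟩
  have := h _ (Set.mem_image_of_mem f hx) _ (Set.mem_image_of_mem f hy) (f.map_adj_iff.2 hvx)
    (f.map_adj_iff.2 hvy)
  simpa only [Set.forall_mem_image, f.map_adj_iff, f.injective.eq_iff] using this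

/-! ### Simple vertices on cycles. -/

theorem cycleGraph_adj_iff_val {n : ℕ} (hn : 2 ≤ n) {u v : Fin n} :
    (SimpleGraph.cycleGraph n).Adj u v ↔
      ((v.val = 0 ∧ u.val + 1 = n) ∨ u.val + 1 = v.val) ∨
      ((u.val = 0 ∧ v.val + 1 = n) ∨ v.val + 1 = u.val) := by
  rw [SimpleGraph.cycleGraph_adj']
  have key : ∀ u v : Fin n, (u - v).val = 1 ↔
      (u.val = 0 ∧ v.val + 1 = n) ∨ v.val + 1 = u.val := by
    intro u v
    have hu := u.isLt
    have hv := v.isLt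
    rcases le_or_gt v u with h | h
    · rw [Fin.sub_val_of_le h]
      have : v.val ≤ u.val := h
      omega
    · rw [Fin.coe_sub_iff_lt.2 h]
      have : u.val < v.val := h
      omega
  rw [key, key, or_comm]

theorem exists_cycleGraph_succ {n : ℕ} (i : Fin n) :
    ∃ s : Fin n, (s.val = 0 ∧ i.val + 1 = n) ∨ i.val + 1 = s.val := by
  have := i.isLt
  by_cases h : i.val + 1 = n
  · exact ⟨⟨0, by omega⟩, .inl ⟨rfl, h⟩⟩
  · exact ⟨⟨i.val + 1, by omega⟩, .inr rfl⟩

theorem exists_cycleGraph_pred {n : ℕ} (i : Fin n) :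
    ∃ p : Fin n, (i.val = 0 ∧ p.val + 1 = n) ∨ p.val + 1 = i.val := by
  have := i.isLt
  by_cases h : i.val = 0
  · exact ⟨⟨n - 1, by omega⟩, .inl ⟨h, by simp only; omega⟩⟩
  · exact ⟨⟨i.val - 1, by omega⟩, .inr (by simp only; omega)⟩

/-- Both neighbors of a simple vertex lie in the larger of their two closed neighborhoods, hence are
adjacent, which fails in a cycle of length at least four. -/
theorem HasSimpleVertices.isChordal {V : Type} {G : SimpleGraph V} (hG : HasSimpleVertices G) :
    IsChordal G := by
  refine fun n hn => ⟨fun f => ?_⟩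
  obtain ⟨i, -, h⟩ := hG.comap f Set.univ ⟨⟨0, by omega⟩, trivial⟩
  obtain ⟨s, hs⟩ := exists_cycleGraph_succ i
  obtain ⟨p, hp⟩ := exists_cycleGraph_pred i
  have hi := i.isLt
  rcases h p trivial s trivial ((cycleGraph_adj_iff_val (by omega)).2 (.inr hp))
    ((cycleGraph_adj_iff_val (by omega)).2 (.inl hs)) with h | h
  · have := h p trivial (.inl rfl)
    rw [cycleGraph_adj_iff_val (by omega), Fin.ext_iff] at this
    omega
  · have := h s trivial (.inl rfl)
    rw [cycleGraph_adj_iff_val (by omega), Fin.ext_iff] at this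
    omega

/-- Apply simplicity to the vertex set of the cycle. If the closed neighborhood of one cycle
neighbor of the simple vertex is contained in that of the other, then the next vertex `p'` or `s'`
beyond the former is adjacent to the latter. The two ends are three steps apart: this distance is
odd, and they are distinct and not consecutive since the length is even and at least six. -/
theorem HasSimpleVertices.exists_odd_chord {V : Type} {G : SimpleGraph V}
    (hG : HasSimpleVertices G) {l : ℕ} (hl : 3 ≤ l)
    (f : SimpleGraph.Copy (SimpleGraph.cycleGraph (2 * l)) G) :
    ∃ i j : Fin (2 * l), G.Adj (f i) (f j) ∧
      ¬ (SimpleGraph.cycleGraph (2 * l)).Adj i j ∧ i.val % 2 ≠ j.val % 2 := by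
  have hadj : ∀ {i j}, (SimpleGraph.cycleGraph (2 * l)).Adj i j → G.Adj (f i) (f j) :=
    fun h => f.toHom.map_adj h
  obtain ⟨_, ⟨i, rfl⟩, h⟩ := hG (Set.range f) ⟨_, ⟨0, by omega⟩, rfl⟩
  obtain ⟨s, hs⟩ := exists_cycleGraph_succ i
  obtain ⟨p, hp⟩ := exists_cycleGraph_pred i
  obtain ⟨s', hs'⟩ := exists_cycleGraph_succ s
  obtain ⟨p', hp'⟩ := exists_cycleGraph_pred p
  have hi := i.isLt
  rcases h (f p) ⟨p, rfl⟩ (f s) ⟨s, rfl⟩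
    (hadj ((cycleGraph_adj_iff_val (by omega)).2 (.inr hp)))
    (hadj ((cycleGraph_adj_iff_val (by omega)).2 (.inl hs))) with h | h
  · rcases h (f p') ⟨p', rfl⟩ (.inr (hadj ((cycleGraph_adj_iff_val (by omega)).2 (.inr hp'))))
      with h | h
    · have := f.injective h
      rw [Fin.ext_iff] at this
      omega
    · refine ⟨s, p', h, ?_, by omega⟩
      rw [cycleGraph_adj_iff_val (by omega)]
      omega
  · rcases h (f s') ⟨s', rfl⟩ (.inr (hadj ((cycleGraph_adj_iff_val (by omega)).2 (.inl hs'))))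
      with h | h
    · have := f.injective h
      rw [Fin.ext_iff] at this
      omega
    · refine ⟨p, s', h, ?_, by omega⟩
      rw [cycleGraph_adj_iff_val (by omega)]
      omega

theorem HasSimpleVertices.mem_stronglyChordalGraphs {G : FinGraph}
    (hG : HasSimpleVertices G.graph) : G ∈ stronglyChordalGraphs :=
  ⟨hG.isChordal, fun _ hl f => hG.exists_odd_chord hl f⟩

/-! ### Burling strongly chordal graphs are strongly chordal -/

namespace BurlingTree

variable {V : Type} [Finite V] (T : BurlingTree V)

/-- Each nonempty set `s` contains a vertex `v` with no proper descendant in `s` that is not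
chosen by any vertex of `s`. -/
theorem exists_lowest_not_chosen {s : Set V} (hs : s.Nonempty) :
    ∃ v ∈ s, (∀ w ∈ s, T.AncLE v w → w = v) ∧ ∀ u ∈ s, v ∉ T.choose u := by
  -- The claim is localized to the subtree of `t`, where only members of `s` in that subtree must
  -- not choose `v`; induction is on the size of the subtree.
  suffices key : ∀ t, (∃ w ∈ s, T.AncLE t w) →
      ∃ v ∈ s, T.AncLE t v ∧ (∀ w ∈ s, T.AncLE v w → w = v) ∧
        ∀ u ∈ s, T.AncLE t u → v ∉ T.choose u by
    obtain ⟨w, hw⟩ := hs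
    obtain ⟨v, hv, -, h, h'⟩ := key T.root ⟨w, hw, T.root_ancLE w⟩
    exact ⟨v, hv, h, fun u hu => h' u hu (T.root_ancLE u)⟩
  -- Otherwise `t` and its last-born sibling would have the common descendant `v`.
  have hnot : ∀ t v, T.AncLE t v → v ∉ T.choose t := by
    intro t v htv hv
    obtain ⟨q, hq, hne, hqv, -⟩ := exists_isParent_of_mem_choose hv
    exact hne (hq.eq_of_ancLE (isParent_lastBorn_of_isParent hq) htv hqv)
  have hchild : ∀ t w, T.AncLE t w → w ≠ t → ∃ c, T.IsParent t c ∧ T.AncLE c w := by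
    intro t w h hne
    rcases Relation.ReflTransGen.cases_head h with h | ⟨c, h, h'⟩
    · exact absurd h.symm hne
    · exact ⟨c, h, h'⟩
  intro t
  induction hn : {w | T.AncLE t w}.ncard using Nat.strong_induction_on generalizing t with
  | _ n ih =>
    have ih' : ∀ c, T.IsParent t c → (∃ w ∈ s, T.AncLE c w) →
        ∃ v ∈ s, T.AncLE c v ∧ (∀ w ∈ s, T.AncLE v w → w = v) ∧
          ∀ u ∈ s, T.AncLE c u → v ∉ T.choose u := by
      intro c hc
      refine ih _ ?_ c rfl
      rw [← hn]
      refine Set.ncard_lt_ncard ⟨fun w hw => hc.ancLE.trans hw, fun h => ?_⟩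
      exact hc.not_ancLE (h (TreeWithRoot.AncLE.refl t))
    rintro ⟨w, hw, htw⟩
    by_cases h0 : ∀ w ∈ s, T.AncLE t w → w = t
    · obtain rfl := h0 w hw htw
      refine ⟨w, hw, .refl _, h0, fun u hu hwu => ?_⟩
      obtain rfl := h0 u hu hwu
      exact hnot _ _ (.refl _)
    -- A child that is not last-born is preferred: vertices below it cannot be chosen by children of
    -- `t`, since those choose only below the last-born. Any other chooser below `t` lies in the
    -- same subtree of `c`.
    by_cases h1 : ∃ c, T.IsParent t c ∧ c ≠ T.lastBorn t ∧ ∃ w ∈ s, T.AncLE c w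
    · obtain ⟨c, hc, hne, hw⟩ := h1
      obtain ⟨v, hv, hcv, h2, h3⟩ := ih' c hc hw
      refine ⟨v, hv, hc.ancLE.trans hcv, h2, fun u hu htu hvu => ?_⟩
      by_cases hut : u = t
      · subst hut
        exact hnot _ _ (hc.ancLE.trans hcv) hvu
      obtain ⟨q, hq, -, hqv, -⟩ := exists_isParent_of_mem_choose hvu
      have hlb := isParent_lastBorn_of_isParent hq
      by_cases hqt : q = t
      · subst hqt
        exact hne (hc.eq_of_ancLE hlb hcv hqv)
      obtain ⟨c', hc', hcq⟩ := hchild t q (htu.of_isParent hq (Ne.symm hut)) hqt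
      obtain rfl := hc.eq_of_ancLE hc' hcv (hcq.trans (hlb.ancLE.trans hqv))
      exact h3 u hu (hcq.trans hq.ancLE) hvu
    -- Now only the last-born child of `t` has members of `s` below it, so every possible chooser
    -- other than `t` is covered by the induction hypothesis for that child.
    · push Not at h0 h1
      obtain ⟨w, hw, htw, hwt⟩ := h0
      obtain ⟨c, hc, hcw⟩ := hchild t w htw hwt
      obtain ⟨v, hv, hcv, h2, h3⟩ := ih' c hc ⟨w, hw, hcw⟩
      refine ⟨v, hv, hc.ancLE.trans hcv, h2, fun u hu htu hvu => ?_⟩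
      by_cases hut : u = t
      · subst hut
        exact hnot _ _ (hc.ancLE.trans hcv) hvu
      obtain ⟨c', hc', hcu⟩ := hchild t u htu hut
      have e : ∀ d w, T.IsParent t d → w ∈ s → T.AncLE d w → d = T.lastBorn t := by
        intro d w hd hw hdw
        by_contra hne
        exact h1 d hd hne w hw hdw
      rw [e c' u hc' hu hcu, ← e c w hc hw hcw] at hcu
      exact h3 u hu hcu hvu

/-- Each nonempty set `s` contains a vertex whose neighbors in `s` form a chain. -/
theorem exists_neighbors_chain {s : Set V} (hs : s.Nonempty) :
    ∃ v ∈ s, ∀ x ∈ s, ∀ y ∈ s, T.chordalGraph.Adj v x → T.chordalGraph.Adj v y →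
      T.AncLE x y ∨ T.AncLE y x := by
  obtain ⟨v, hv, hlow, hch⟩ := T.exists_lowest_not_chosen hs
  have hnb : ∀ x ∈ s, T.chordalGraph.Adj v x → x ∈ T.choose v ∨ (x ≠ v ∧ T.AncLE x v) := by
    intro x hx h
    obtain ⟨hne, h | h | h | h⟩ := chordalGraph_adj.1 h
    · exact .inl h
    · exact absurd h (hch x hx)
    · exact absurd (hlow x hx h).symm hne
    · exact .inr ⟨hne.symm, h⟩
  -- A proper ancestor of `v` is above the parent of `v`, which is above the whole branch chosen by
  -- `v`.
  have hmix : ∀ x y, x ∈ T.choose v → y ≠ v → T.AncLE y v → T.AncLE y x := by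
    intro x y hx hne hy
    obtain ⟨q, hq, -, hqx, -⟩ := exists_isParent_of_mem_choose hx
    exact (hy.of_isParent hq hne).trans ((isParent_lastBorn_of_isParent hq).ancLE.trans hqx)
  refine ⟨v, hv, fun x hx y hy hvx hvy => ?_⟩
  rcases hnb x hx hvx with h | ⟨hne, h⟩ <;> rcases hnb y hy hvy with h' | ⟨hne', h'⟩
  · obtain ⟨q, -, -, -, -, hc⟩ := exists_isParent_of_mem_choose h'
    exact (hc x h).2
  · exact .inr (hmix x y h hne' h')
  · exact .inl (hmix y x h' hne h)
  · exact h.total h'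

/-- Closed neighborhoods decrease along a branch. -/
theorem closedNeighborhood_anti {x y z : V} (hxy : T.AncLE x y)
    (h : z = y ∨ T.chordalGraph.Adj y z) : z = x ∨ T.chordalGraph.Adj x z := by
  by_cases hzx : z = x
  · exact .inl hzx
  by_cases hyx : x = y
  · exact hyx ▸ h
  right
  rw [chordalGraph_adj]
  refine ⟨Ne.symm hzx, ?_⟩
  rcases h with rfl | h
  · exact .inr (.inr (.inl hxy))
  obtain ⟨-, h | h | h | h⟩ := chordalGraph_adj.1 h
  · obtain ⟨q, hq, -, hqz, -⟩ := exists_isParent_of_mem_choose h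
    exact .inr (.inr (.inl ((hxy.of_isParent hq hyx).trans
      ((isParent_lastBorn_of_isParent hq).ancLE.trans hqz))))
  · obtain ⟨q, hq, -, hqy, hconv, -⟩ := exists_isParent_of_mem_choose h
    -- Here `z` chooses `y`. Either `x` lies between the first vertex of the chosen branch and `y`,
    -- so `z` chooses `x` too, or `x` is properly above that first vertex, hence above the parent
    -- `q` of `z`.
    by_cases hqx : T.AncLE (T.lastBorn q) x
    · exact .inr (.inl (hconv x hqx hxy))
    · have hne : x ≠ T.lastBorn q := by
        rintro rfl
        exact hqx (.refl _)
      exact .inr (.inr (.inl ((((hxy.total hqy).resolve_right hqx).of_isParent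
        (isParent_lastBorn_of_isParent hq) hne).trans hq.ancLE)))
  · exact .inr (.inr (.inl (hxy.trans h)))
  · exact .inr (.inr (hxy.total h))

theorem hasSimpleVertices_chordalGraph : HasSimpleVertices T.chordalGraph := by
  intro s hs
  obtain ⟨v, hv, h⟩ := T.exists_neighbors_chain hs
  refine ⟨v, hv, fun x hx y hy hvx hvy => ?_⟩
  rcases h x hx y hy hvx hvy with h | h
  · exact .inr fun z _ => T.closedNeighborhood_anti h
  · exact .inl fun z _ => T.closedNeighborhood_anti h

end BurlingTree

theorem isHereditary_burlingStronglyChordalGraphs :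
    IsHereditary burlingStronglyChordalGraphs := by
  rintro G ⟨V, hV, T, ⟨f⟩⟩ H ⟨g⟩
  exact ⟨V, hV, T, ⟨g.trans f⟩⟩

theorem burlingStronglyChordalGraphs_subset :
    burlingStronglyChordalGraphs ⊆ stronglyChordalGraphs := by
  rintro G ⟨V, hV, T, ⟨f⟩⟩
  exact (T.hasSimpleVertices_chordalGraph.comap f).mem_stronglyChordalGraphs

/-! ### A strongly chordal graph that is not Burling strongly chordal -/

/-- The path on four vertices with each vertex replaced by a triangle. -/
def inflatedPath : SimpleGraph (Fin 4 × Fin 3) where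
  Adj u v := u ≠ v ∧ u.1.val ≤ v.1.val + 1 ∧ v.1.val ≤ u.1.val + 1
  symm := ⟨fun _ _ h => ⟨h.1.symm, h.2.2, h.2.1⟩⟩
  loopless := ⟨fun _ h => h.1 rfl⟩

/-- A vertex of `s` in the leftmost occupied triangle is simple: its neighbors lie in that triangle
or the next, and those further right see at least as much of `s`. -/
theorem hasSimpleVertices_inflatedPath : HasSimpleVertices inflatedPath := by
  intro s hs
  obtain ⟨v, hv, hmin⟩ := Set.exists_min_image s (fun v => v.1.val) (Set.toFinite s) hs
  have key : ∀ x ∈ s, ∀ y ∈ s, inflatedPath.Adj v x → inflatedPath.Adj v y →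
      x.1.val ≤ y.1.val → ∀ z ∈ s, z = x ∨ inflatedPath.Adj x z → z = y ∨ inflatedPath.Adj y z := by
    intro x hx y hy hvx hvy hxy z hz h
    by_cases hzy : z = y
    · exact .inl hzy
    right
    have h1 := hmin z hz
    have h2 := hvy.2
    have h3 : z.1.val ≤ x.1.val + 1 := by
      rcases h with rfl | h
      · omega
      · exact h.2.2
    exact ⟨Ne.symm hzy, by omega, by omega⟩
  refine ⟨v, hv, fun x hx y hy hvx hvy => ?_⟩
  rcases le_total x.1.val y.1.val with h | h
  · exact .inl (key x hx y hy hvx hvy h)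
  · exact .inr (key y hy x hx hvy hvx h)

theorem inflatedPath_not_mem_burlingStronglyChordalGraphs :
    FinGraph.mk (Fin 4 × Fin 3) inflatedPath ∉ burlingStronglyChordalGraphs := by
  rintro ⟨V, hV, T, ⟨f⟩⟩
  change inflatedPath ↪g T.chordalGraph at f
  have hadj : ∀ u v, T.AncLE (f u) (f v) ∨ T.AncLE (f v) (f u) → u ≠ v → inflatedPath.Adj u v := by
    intro u v h hne
    exact f.map_adj_iff.1 (BurlingTree.chordalGraph_adj.2 ⟨f.injective.ne hne, .inr (.inr h)⟩)
  -- Triangles `i` and `i + 1` form a clique, so the vertex `e` given by `exists_neighbors_chain` is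
  -- adjacent to all the others, which therefore form a chain.
  have hclique : ∀ i : ℕ, i < 4 → ∃ e, ∀ x y : Fin 4 × Fin 3,
      i ≤ x.1.val → x.1.val ≤ i + 1 → i ≤ y.1.val → y.1.val ≤ i + 1 → x ≠ e → y ≠ e →
      T.AncLE (f x) (f y) ∨ T.AncLE (f y) (f x) := by
    intro i hi
    obtain ⟨_, ⟨e, he, rfl⟩, h⟩ := T.exists_neighbors_chain
      (s := f '' {x | i ≤ x.1.val ∧ x.1.val ≤ i + 1})
      ⟨_, (⟨i, hi⟩, 0), ⟨le_rfl, Nat.le_succ i⟩, rfl⟩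
    have hnb : ∀ x : Fin 4 × Fin 3, i ≤ x.1.val → x.1.val ≤ i + 1 → x ≠ e →
        T.chordalGraph.Adj (f e) (f x) := by
      intro x h1 h2 hne
      have h3 := he.1
      have h4 := he.2
      exact f.map_adj_iff.2 ⟨hne.symm, by omega, by omega⟩
    exact ⟨e, fun x y h1 h2 h3 h4 hx hy => h _ (Set.mem_image_of_mem f ⟨h1, h2⟩) _
      (Set.mem_image_of_mem f ⟨h3, h4⟩) (hnb x h1 h2 hx) (hnb y h3 h4 hy)⟩
  obtain ⟨e₀, h₀⟩ := hclique 0 (by omega)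
  obtain ⟨e₁, h₁⟩ := hclique 1 (by omega)
  obtain ⟨e₂, h₂⟩ := hclique 2 (by omega)
  -- Each triangle belongs to at most two of the three cliques and so loses at most two of its three
  -- vertices.
  have avoid : ∀ (i : Fin 4) (e e' : Fin 4 × Fin 3), ∃ a : Fin 3, (i, a) ≠ e ∧ (i, a) ≠ e' := by
    rintro i ⟨j, b⟩ ⟨j', b'⟩
    have : ∀ b b' : Fin 3, ∃ a, a ≠ b ∧ a ≠ b' := by decide
    obtain ⟨a, ha, ha'⟩ := this b b'
    exact ⟨a, fun h => ha (congrArg Prod.snd h), fun h => ha' (congrArg Prod.snd h)⟩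
  obtain ⟨a, ha, -⟩ := avoid 0 e₀ e₀
  obtain ⟨b, hb, hb'⟩ := avoid 1 e₀ e₁
  obtain ⟨c, hc, hc'⟩ := avoid 2 e₁ e₂
  obtain ⟨d, hd, -⟩ := avoid 3 e₂ e₂
  have hab := h₀ (0, a) (1, b) (by simp) (by simp) (by simp) (by simp) ha hb
  have hbc := h₁ (1, b) (2, c) (by simp) (by simp) (by simp) (by simp) hb' hc
  have hcd := h₂ (2, c) (3, d) (by simp) (by simp) (by simp) (by simp) hc' hd
  have hac : ¬ (T.AncLE (f (0, a)) (f (2, c)) ∨ T.AncLE (f (2, c)) (f (0, a))) := fun h => by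
    simpa using (hadj _ _ h (by simp)).2
  have hbd : ¬ (T.AncLE (f (1, b)) (f (3, d)) ∨ T.AncLE (f (3, d)) (f (1, b))) := fun h => by
    simpa using (hadj _ _ h (by simp)).2
  -- Vertices above a common vertex are comparable, so with `a`, `c` incomparable, `b` must be above
  -- `c`. The same reasoning at `c` then makes `b` and `d` comparable.
  have h1 : T.AncLE (f (1, b)) (f (2, c)) := by
    by_contra h
    have h' := hbc.resolve_left h
    rcases hab with h'' | h''
    · exact hac (h''.total h')
    · exact hac (.inr (h'.trans h''))
  rcases hcd with h | h
  · exact hbd (.inl (h1.trans h))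
  · exact hbd (h1.total h)

theorem burlingStronglyChordalGraphs_ssubset :
    burlingStronglyChordalGraphs ⊂ stronglyChordalGraphs :=
  ⟨burlingStronglyChordalGraphs_subset, fun h =>
    inflatedPath_not_mem_burlingStronglyChordalGraphs
      (h hasSimpleVertices_inflatedPath.mem_stronglyChordalGraphs)⟩

/-! ### Trivially perfect graphs from forest orders -/

/-- Read `R a b` as "`a` is above `b`". The maximal cliques are the sets `C m` of a lowest vertex
`m` with everything above it, so they are counted by the set `M` of lowest vertices. `M` is
independent, and sending each vertex of an independent set to a lowest vertex below it is injective
because each `C m` is a clique. -/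
theorem indepNum_eq_ncard_maximal_isClique {α : Type} [Finite α] [Nonempty α]
    {G : SimpleGraph α} (R : α → α → Prop) (htrans : ∀ a b c, R a b → R b c → R a c)
    (hchain : ∀ a b c, R a c → R b c → a = b ∨ R a b ∨ R b a)
    (hG : ∀ a b, G.Adj a b ↔ R a b ∨ R b a) :
    G.indepNum = {c : Set α | Maximal G.IsClique c}.ncard := by
  classical
  have hirr : ∀ a, ¬ R a a := fun a h => G.loopless.irrefl a ((hG a a).2 (.inl h))
  have hwf : WellFounded (Function.swap R) := by
    have : IsTrans α (Function.swap R) := ⟨fun a b c h h' => htrans c b a h' h⟩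
    have : Std.Irrefl (Function.swap R) := ⟨hirr⟩
    exact Finite.wellFounded_of_trans_of_irrefl _
  let M : Set α := {m | ∀ a, ¬ R m a}
  let C : α → Set α := fun m => {u | u = m ∨ R u m}
  have hbelow : ∀ a, ∃ m ∈ M, a ∈ C m := by
    intro a
    obtain ⟨m, hm, hmin⟩ := hwf.has_min {m | a ∈ C m} ⟨a, .inl rfl⟩
    refine ⟨m, fun b hb => hmin b ?_ hb, hm⟩
    rcases hm with rfl | hm
    · exact .inr hb
    · exact .inr (htrans _ _ _ hm hb)
  have hcomp : ∀ m, ∀ a ∈ C m, ∀ b ∈ C m, a = b ∨ R a b ∨ R b a := by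
    rintro m a (rfl | ha) b (rfl | hb)
    · exact .inl rfl
    · exact .inr (.inr hb)
    · exact .inr (.inl ha)
    · exact hchain a b m ha hb
  have hmax : ∀ m ∈ M, Maximal G.IsClique (C m) := by
    intro m hm
    refine ⟨fun a ha b hb hne => (hG a b).2 ((hcomp m a ha b hb).resolve_left hne),
      fun c hc hle x hx => ?_⟩
    by_cases hxm : x = m
    · exact .inl hxm
    · exact .inr (((hG x m).1 (hc hx (hle (.inl rfl)) hxm)).resolve_right (hm x))
  have hset : {c : Set α | Maximal G.IsClique c} = C '' M := by
    ext c
    constructor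
    · intro hc
      have hne : c.Nonempty := by
        by_contra h
        rw [Set.not_nonempty_iff_eq_empty] at h
        subst h
        obtain ⟨a⟩ := ‹Nonempty α›
        exact hc.2 (y := {a}) (Set.pairwise_singleton a _) (Set.empty_subset _) rfl
      obtain ⟨m₀, hm₀, hmin⟩ := hwf.has_min c hne
      obtain ⟨m, hm, hm₀m⟩ := hbelow m₀
      -- All of the clique `c` lies above its lowest vertex `m₀`, hence above `m`; maximality turns
      -- the inclusion into equality.
      have hle : c ⊆ C m := by
        intro x hx
        by_cases hxm : x = m₀
        · exact hxm ▸ hm₀m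
        · have h := ((hG x m₀).1 (hc.1 hx hm₀ hxm)).resolve_right (hmin x hx)
          rcases hm₀m with rfl | h'
          · exact .inr h
          · exact .inr (htrans _ _ _ h h')
      exact ⟨m, hm, (hle.antisymm (hc.2 (hmax m hm).1 hle)).symm⟩
    · rintro ⟨m, hm, rfl⟩
      exact hmax m hm
  have hinj : Set.InjOn C M := by
    intro m hm m' hm' h
    have : m ∈ C m' := h ▸ .inl rfl
    exact this.resolve_right (hm m')
  rw [hset, hinj.ncard_image]
  apply le_antisymm
  · obtain ⟨s, hs⟩ := G.exists_isNIndepSet_indepNum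
    choose g hgM hg using hbelow
    rw [← hs.card_eq, ← Set.ncard_coe_finset]
    refine Set.ncard_le_ncard_of_injOn g (fun a _ => hgM a) fun a ha b hb hab => ?_
    by_contra hne
    exact hs.isIndepSet ha hb hne
      ((hG a b).2 ((hcomp (g a) a (hg a) b (hab ▸ hg b)).resolve_left hne))
  · have hfin : M.Finite := Set.toFinite M
    have : G.IsIndepSet (hfin.toFinset : Set α) := by
      rw [hfin.coe_toFinset]
      intro a ha b hb _ h
      rcases (hG a b).1 h with h | h
      · exact ha b h
      · exact hb a h
    rw [Set.ncard_eq_toFinset_card M hfin]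
    exact this.card_le_indepNum

/-- The comparability graph of a forest order is trivially perfect. -/
theorem mem_triviallyPerfectGraphs {G : FinGraph} (R : G.V → G.V → Prop)
    (htrans : ∀ a b c, R a b → R b c → R a c)
    (hchain : ∀ a b c, R a c → R b c → a = b ∨ R a b ∨ R b a)
    (hG : ∀ a b, G.graph.Adj a b ↔ R a b ∨ R b a) : G ∈ triviallyPerfectGraphs := by
  intro s hs
  have := hs.to_subtype
  exact indepNum_eq_ncard_maximal_isClique (fun a b : s => R a b)
    (fun a b c => htrans a b c)
    (fun a b c h h' => by simpa only [Subtype.ext_iff] using hchain a b c h h')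
    (fun a b => hG a b)

/-! ### The forest order of a Burling tree -/

namespace BurlingTree

variable {V : Type} (T : BurlingTree V)

/-- For an injective `f : V → ℕ`, used to order siblings: `u` is not last-born, and `a` is below
the last-born sibling of `u` or is a sibling of `u` that is not last-born and follows `u`. -/
def Precedes (f : V → ℕ) (u a : V) : Prop :=
  ∃ q, T.IsParent q u ∧ u ≠ T.lastBorn q ∧
    (T.AncLE (T.lastBorn q) a ∨ (T.IsParent q a ∧ a ≠ T.lastBorn q ∧ f u < f a))

variable {T} {f : V → ℕ} {u v a b : V}

/-- A vertex that is not last-born lies below a last-born vertex only if its parent does. -/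
theorem ancLE_lastBorn_isParent {q q' : V} (ha : T.IsParent q' a) (hne : a ≠ T.lastBorn q')
    (hq : T.IsParent q (T.lastBorn q)) (h : T.AncLE (T.lastBorn q) a) :
    T.AncLE (T.lastBorn q) q' := by
  refine h.of_isParent ha ?_
  rintro rfl
  exact hne (by rw [ha.unique hq])

theorem Precedes.of_mem_choose (h : a ∈ T.choose u) : T.Precedes f u a := by
  obtain ⟨q, hq, hne, hqa, -⟩ := exists_isParent_of_mem_choose h
  exact ⟨q, hq, hne, .inl hqa⟩

/-- If `a` is below the last-born of `q` but not itself last-born, its parent is below that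
last-born as well, and so is everything that `a` precedes. If `a` is a sibling of `u`, both refer to
the same last-born. -/
theorem Precedes.trans (h : T.Precedes f u a) (h' : T.Precedes f a b) : T.Precedes f u b := by
  obtain ⟨q, hq, hne, h⟩ := h
  obtain ⟨q', hq', hne', h'⟩ := h'
  refine ⟨q, hq, hne, ?_⟩
  rcases h with h | ⟨ha, -, hlt⟩
  · have h1 := ancLE_lastBorn_isParent hq' hne' (isParent_lastBorn_of_isParent hq) h
    rcases h' with h' | ⟨h', -⟩
    · exact .inl (h1.trans ((isParent_lastBorn_of_isParent hq').ancLE.trans h'))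
    · exact .inl (h1.trans h'.ancLE)
  · obtain rfl := ha.unique hq'
    rcases h' with h' | ⟨h', h2, hlt'⟩
    · exact .inl h'
    · exact .inr ⟨h', h2, hlt.trans hlt'⟩

/-- Siblings are compared by `f`. If the parents differ, `a` lies below last-born children of both
or can be replaced by its own parent, and the higher of the two last-borns is above the other
parent. -/
theorem Precedes.total (hf : Function.Injective f) (hu : T.Precedes f u a)
    (hv : T.Precedes f v a) : u = v ∨ T.Precedes f u v ∨ T.Precedes f v u := by
  obtain ⟨q, hq, hne, hu⟩ := hu
  obtain ⟨q', hq', hne', hv⟩ := hv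
  by_cases hqq : q = q'
  · subst hqq
    rcases lt_trichotomy (f u) (f v) with h | h | h
    · exact .inr (.inl ⟨q, hq, hne, .inr ⟨hq', hne', h⟩⟩)
    · exact .inl (hf h)
    · exact .inr (.inr ⟨q, hq', hne', .inr ⟨hq, hne, h⟩⟩)
  have hlb := isParent_lastBorn_of_isParent hq
  have hlb' := isParent_lastBorn_of_isParent hq'
  right
  rcases hu with hu | ⟨hu, hua, -⟩ <;> rcases hv with hv | ⟨hv, hva, -⟩
  · rcases hu.total hv with h | h
    · refine .inl ⟨q, hq, hne, .inl ((h.of_isParent hlb' ?_).trans hq'.ancLE)⟩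
      intro e
      rw [e] at hlb
      exact hqq (hlb.unique hlb')
    · refine .inr ⟨q', hq', hne', .inl ((h.of_isParent hlb ?_).trans hq.ancLE)⟩
      intro e
      rw [e] at hlb'
      exact hqq (hlb.unique hlb')
  · exact .inl ⟨q, hq, hne, .inl ((ancLE_lastBorn_isParent hv hva hlb hu).trans hq'.ancLE)⟩
  · exact .inr ⟨q', hq', hne', .inl ((ancLE_lastBorn_isParent hu hua hlb' hv).trans hq.ancLE)⟩
  · exact absurd (hu.unique hv) hqq

/-- The vertex `a` is below a child of `q` different from `u`. This is what removes the branch edges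
of C(T) from the intersection. -/
theorem Precedes.incomparable (h : T.Precedes f u a) : ¬ T.AncLE u a ∧ ¬ T.AncLE a u := by
  obtain ⟨q, hq, hne, h | ⟨ha, -, hlt⟩⟩ := h
  · have hlb := isParent_lastBorn_of_isParent hq
    exact ⟨fun h' => hne (hq.eq_of_ancLE hlb h' h),
      fun h' => hne (hq.eq_of_ancLE hlb (.refl u) (h.trans h'))⟩
  · refine ⟨fun h' => hlt.ne ?_, fun h' => hlt.ne ?_⟩
    · rw [hq.eq_of_ancLE ha h' (.refl a)]
    · rw [hq.eq_of_ancLE ha (.refl u) h']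

theorem derivedGraph_adj : T.derivedGraph.Adj u v ↔
    u ≠ v ∧ (v ∈ T.choose u ∨ u ∈ T.choose v) :=
  SimpleGraph.fromRel_adj _ _ _

/-- Induced subgraphs of derived graphs are intersections of a trivially perfect graph and a Burling
strongly chordal graph. -/
theorem mem_graphIntersection [Finite V] {G : FinGraph} (φ : G.graph ↪g T.derivedGraph) :
    G ∈ graphIntersection triviallyPerfectGraphs burlingStronglyChordalGraphs := by
  -- An arbitrary order of siblings: two siblings that choose a common vertex must be comparable for
  -- `R` to be a forest order. The extra edges are absent from C(T).
  obtain ⟨f, hf⟩ := Countable.exists_injective_nat V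
  let R : G.V → G.V → Prop := fun a b => T.Precedes f (φ a) (φ b)
  have hR : ∀ a b, R a b → a ≠ b := by
    rintro a _ h rfl
    exact h.incomparable.1 (.refl _)
  refine ⟨SimpleGraph.fromRel R, T.chordalGraph.comap φ, ?_, ?_, ?_⟩
  · refine mem_triviallyPerfectGraphs R (fun a b c h h' => h.trans h') (fun a b c h h' => ?_)
      (fun a b => ?_)
    · simpa only [φ.injective.eq_iff] using Precedes.total hf h h'
    · rw [SimpleGraph.fromRel_adj]
      exact ⟨fun h => h.2, fun h => ⟨h.elim (hR a b) fun h => (hR b a h).symm, h⟩⟩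
  · exact ⟨V, ‹_›, T, ⟨SimpleGraph.Embedding.comap φ.toEmbedding T.chordalGraph⟩⟩
  · ext a b
    rw [SimpleGraph.inf_adj, SimpleGraph.fromRel_adj, SimpleGraph.comap_adj, chordalGraph_adj,
      ← φ.map_adj_iff, derivedGraph_adj]
    constructor
    · rintro ⟨hne, h⟩
      exact ⟨⟨fun e => hne (by rw [e]), h.imp Precedes.of_mem_choose Precedes.of_mem_choose⟩, hne,
        h.elim .inl fun h => .inr (.inl h)⟩
    · rintro ⟨⟨-, h⟩, hne, h'⟩
      refine ⟨hne, ?_⟩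
      have hinc : ¬ T.AncLE (φ a) (φ b) ∧ ¬ T.AncLE (φ b) (φ a) :=
        h.elim (fun h => h.incomparable) fun h => h.incomparable.symm
      tauto

end BurlingTree

/-! ### Rooted trees from parent functions -/

namespace TreeWithRoot

variable {V : Type} (par : V → Option V)

/-- The graph that joins each vertex to its parent. -/
def parentGraph (hpar : ∀ v, par v ≠ some v) : SimpleGraph V where
  Adj u v := par v = some u ∨ par u = some v
  symm := ⟨fun _ _ h => h.symm⟩
  loopless := ⟨fun v h => h.elim (hpar v) (hpar v)⟩

variable {par} {hpar : ∀ v, par v ≠ some v} {root : V} {d : V → ℕ}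

/-- The depth bound makes the induction close: a vertex is deeper than all vertices on the path of
its parent, so prepending it keeps a path. -/
theorem exists_path_parentGraph (hroot : ∀ v, par v = none → v = root)
    (hd : ∀ u v, par v = some u → d u < d v) (v : V) :
    ∃ p : (parentGraph par hpar).Walk v root, p.IsPath ∧ ∀ x ∈ p.support, d x ≤ d v := by
  induction hn : d v using Nat.strong_induction_on generalizing v with
  | _ n ih =>
    cases hv : par v with
    | none =>
      obtain rfl := hroot v hv
      exact ⟨.nil, by simp, by simp [hn]⟩
    | some u =>
      have hlt := hd u v hv
      obtain ⟨p, hp, h⟩ := ih (d u) (hn ▸ hlt) u rfl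
      have hadj : (parentGraph par hpar).Adj v u := .inr hv
      refine ⟨.cons hadj p, ?_, ?_⟩
      · rw [SimpleGraph.Walk.cons_isPath_iff]
        exact ⟨hp, fun h' => by have := h v h'; omega⟩
      · intro x hx
        rw [SimpleGraph.Walk.support_cons, List.mem_cons] at hx
        rcases hx with rfl | hx
        · exact hn.le
        · have := h x hx
          omega

/-- The graph is connected through the root, and each edge joins some non-root vertex to its parent,
so there are fewer edges than vertices. -/
theorem isTree_parentGraph [Finite V] (hroot : ∀ v, par v = none ↔ v = root)
    (hd : ∀ u v, par v = some u → d u < d v) : (parentGraph par hpar).IsTree := by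
  have hconn : (parentGraph par hpar).Connected := by
    rw [SimpleGraph.connected_iff_exists_forall_reachable]
    refine ⟨root, fun v => ?_⟩
    obtain ⟨p, -⟩ := exists_path_parentGraph (hpar := hpar) (fun v => (hroot v).1) hd v
    exact ⟨p.reverse⟩
  rw [SimpleGraph.isTree_iff_connected_and_card]
  refine ⟨hconn, le_antisymm ?_ hconn.card_vert_le_card_edgeSet_add_one⟩
  -- The default value of `getD` never matters, since every vertex other than `root` has a parent.
  have hsub : (parentGraph par hpar).edgeSet ⊆
      (fun v => s(v, (par v).getD v)) '' ({root}ᶜ : Set V) := by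
    have key : ∀ u v, par v = some u → s(v, u) ∈
        (fun v => s(v, (par v).getD v)) '' ({root}ᶜ : Set V) := by
      intro u v h
      refine ⟨v, fun hv => ?_, by simp [h]⟩
      rw [(hroot v).2 hv] at h
      cases h
    intro e
    induction e with
    | _ u v =>
      rintro (h | h)
      · exact Sym2.eq_swap ▸ key u v h
      · exact key v u h
  have h1 := (Set.ncard_le_ncard hsub (Set.toFinite _)).trans (Set.ncard_image_le (Set.toFinite _))
  have h2 := Set.ncard_add_ncard_compl {root}
  rw [Set.ncard_singleton] at h2
  rw [Nat.card_coe_set_eq]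
  omega

theorem isParent_iff_par {T : TreeWithRoot V} (hT : T.tree = parentGraph par hpar)
    (hroot : ∀ v, par v = none → v = T.root) (hd : ∀ u v, par v = some u → d u < d v) {u v : V} :
    T.IsParent u v ↔ par v = some u := by
  have key : ∀ u v, par v = some u → T.IsParent u v := by
    intro u v h
    have hadj : T.tree.Adj v u := hT ▸ .inr h
    obtain ⟨p, hp, hle⟩ : ∃ p : T.tree.Walk u T.root, p.IsPath ∧ ∀ x ∈ p.support, d x ≤ d u :=
      hT ▸ exists_path_parentGraph hroot hd u
    exact isParent_iff.2 ⟨hadj, p, (SimpleGraph.Walk.cons_isPath_iff _ _).2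
      ⟨hp, fun h' => (hle v h').not_gt (hd u v h)⟩⟩
  refine ⟨fun h => ?_, key u v⟩
  have hadj : (parentGraph par hpar).Adj u v := hT ▸ h.1
  rcases hadj with h' | h'
  · exact h'
  · exact absurd (key v u h').ancLE h.not_ancLE

end TreeWithRoot

/-! ### The Burling trees of the Burling sequence

The tree of the next family is obtained from the current one by attaching to the leaf of each probe
`P` a copy of the current tree, whose root is the last-born child of that leaf, and one further child
for each probe `Q`, which chooses the principal branch of `Q` in the attached copy. -/

namespace Burling

instance finite_probeIdx : ∀ k, Finite (ProbeIdx k)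
  | 0 => inferInstanceAs (Finite Unit)
  | k + 1 =>
    have := finite_probeIdx k
    inferInstanceAs (Finite (ProbeIdx k × ProbeIdx k × Bool))

instance finite_boxIdx : ∀ k, Finite (BoxIdx k)
  | 0 => inferInstanceAs (Finite Unit)
  | k + 1 =>
    have := finite_boxIdx k
    inferInstanceAs (Finite (BoxIdx k ⊕ (ProbeIdx k × BoxIdx k) ⊕ (ProbeIdx k × ProbeIdx k)))

/-- The box of the next family that is a translate of `v`. -/
def baseBox {k : ℕ} (v : BoxIdx k) : BoxIdx (k + 1) := .inl v

/-- The box of the next family that is the copy of `v` inside the column of `P`. -/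
def copyBox {k : ℕ} (P : ProbeIdx k) (v : BoxIdx k) : BoxIdx (k + 1) := .inr (.inl (P, v))

/-- The box of the next family added for the pair of probes `P, Q`. -/
def addedBox {k : ℕ} (P Q : ProbeIdx k) : BoxIdx (k + 1) := .inr (.inr (P, Q))

/-- The probes of the next family. -/
def nextProbe {k : ℕ} (P Q : ProbeIdx k) (b : Bool) : ProbeIdx (k + 1) := (P, Q, b)

theorem boxIdx_succ_cases {k : ℕ} (v : BoxIdx (k + 1)) :
    (∃ u, v = baseBox u) ∨ (∃ P u, v = copyBox P u) ∨ ∃ P Q, v = addedBox P Q := by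
  rcases v with v | ⟨P, v⟩ | ⟨P, Q⟩
  · exact .inl ⟨v, rfl⟩
  · exact .inr (.inl ⟨P, v, rfl⟩)
  · exact .inr (.inr ⟨P, Q, rfl⟩)

section

variable {k : ℕ} {u v : BoxIdx k} {P P' Q Q' : ProbeIdx k} {b : Bool}

@[simp] theorem baseBox_inj : baseBox u = baseBox v ↔ u = v :=
  Sum.inl_injective.eq_iff

@[simp] theorem copyBox_inj : copyBox P u = copyBox P' v ↔ P = P' ∧ u = v :=
  (Sum.inr_injective.comp Sum.inl_injective).eq_iff.trans Prod.mk_inj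

@[simp] theorem addedBox_inj : addedBox P Q = addedBox P' Q' ↔ P = P' ∧ Q = Q' :=
  (Sum.inr_injective.comp Sum.inr_injective).eq_iff.trans Prod.mk_inj

@[simp] theorem baseBox_ne_copyBox : baseBox u ≠ copyBox P v := Sum.inl_ne_inr

@[simp] theorem copyBox_ne_baseBox : copyBox P v ≠ baseBox u := Sum.inr_ne_inl

@[simp] theorem baseBox_ne_addedBox : baseBox u ≠ addedBox P Q := Sum.inl_ne_inr

@[simp] theorem addedBox_ne_baseBox : addedBox P Q ≠ baseBox u := Sum.inr_ne_inl

@[simp] theorem copyBox_ne_addedBox : copyBox P v ≠ addedBox P' Q :=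
  fun h => Sum.inl_ne_inr (Sum.inr_injective h)

@[simp] theorem addedBox_ne_copyBox : addedBox P' Q ≠ copyBox P v :=
  fun h => Sum.inr_ne_inl (Sum.inr_injective h)

@[simp] theorem stabs_baseBox : Stabs (k + 1) (nextProbe P Q b) (baseBox v) ↔ Stabs k P v := .rfl

@[simp] theorem stabs_copyBox : Stabs (k + 1) (nextProbe P Q b) (copyBox P' v) ↔
    b = false ∧ P' = P ∧ Stabs k Q v := .rfl

@[simp] theorem stabs_addedBox : Stabs (k + 1) (nextProbe P Q b) (addedBox P' Q') ↔
    b = true ∧ P' = P ∧ Q' = Q := .rfl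

end

/-- The root of the tree. -/
def treeRoot : (k : ℕ) → BoxIdx k
  | 0 => ()
  | k + 1 => baseBox (treeRoot k)

/-- The leaf at which the principal branch of a probe ends. -/
def leaf : (k : ℕ) → ProbeIdx k → BoxIdx k
  | 0, _ => ()
  | k + 1, (P, Q, false) => copyBox P (leaf k Q)
  | _ + 1, (P, Q, true) => addedBox P Q

/-- The parent function of the tree. -/
def parent : (k : ℕ) → BoxIdx k → Option (BoxIdx k)
  | 0, _ => none
  | k + 1, .inl v => (parent k v).map baseBox
  | k + 1, .inr (.inl (P, v)) => some ((parent k v).elim (baseBox (leaf k P)) (copyBox P))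
  | k + 1, .inr (.inr (P, _)) => some (baseBox (leaf k P))

/-- The number of proper ancestors of a vertex. -/
def depth : (k : ℕ) → BoxIdx k → ℕ
  | 0, _ => 0
  | k + 1, .inl v => depth k v
  | k + 1, .inr (.inl (P, v)) => depth k (leaf k P) + 1 + depth k v
  | k + 1, .inr (.inr (P, _)) => depth k (leaf k P) + 1

open Classical in
/-- The last-born child. -/
noncomputable def lastBorn : (k : ℕ) → BoxIdx k → BoxIdx k
  | 0, _ => ()
  | k + 1, .inl v =>
      if h : ∃ P, leaf k P = v then copyBox h.choose (treeRoot k) else baseBox (lastBorn k v)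
  | k + 1, .inr (.inl (P, v)) => copyBox P (lastBorn k v)
  -- Added boxes are leaves, so this value is irrelevant.
  | _ + 1, .inr (.inr (P, Q)) => addedBox P Q

/-- The choose function of the tree, as a relation. -/
def Chooses : (k : ℕ) → BoxIdx k → BoxIdx k → Prop
  | 0, _, _ => False
  | k + 1, .inl u, .inl w => Chooses k u w
  | k + 1, .inr (.inl (P, u)), .inr (.inl (P', w)) => P = P' ∧ Chooses k u w
  | k + 1, .inr (.inr (P, Q)), .inr (.inl (P', w)) => P = P' ∧ Stabs k Q w
  | _ + 1, _, _ => False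

/-- `Chooses` orients every edge from an added box to a member of its stable set. -/
theorem abstractAdj_iff_chooses (k : ℕ) (u v : BoxIdx k) :
    AbstractAdj k u v ↔ Chooses k u v ∨ Chooses k v u := by
  induction k with
  | zero => simp [AbstractAdj, Chooses]
  | succ k ih =>
    rcases u with u | ⟨P, u⟩ | ⟨P, Q⟩ <;> rcases v with v | ⟨P', v⟩ | ⟨P', Q'⟩ <;>
      simp only [AbstractAdj, Chooses, ih, or_self, or_false, false_or] <;> grind

section

variable {k : ℕ} {u v w : BoxIdx k} {P P' Q Q' : ProbeIdx k}

@[simp] theorem leaf_nextProbe_false : leaf (k + 1) (nextProbe P Q false) = copyBox P (leaf k Q) :=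
  rfl

@[simp] theorem leaf_nextProbe_true : leaf (k + 1) (nextProbe P Q true) = addedBox P Q := rfl

@[simp] theorem parent_baseBox : parent (k + 1) (baseBox v) = (parent k v).map baseBox := rfl

@[simp] theorem parent_copyBox : parent (k + 1) (copyBox P v) =
    some ((parent k v).elim (baseBox (leaf k P)) (copyBox P)) := rfl

@[simp] theorem parent_addedBox : parent (k + 1) (addedBox P Q) = some (baseBox (leaf k P)) := rfl

@[simp] theorem depth_baseBox : depth (k + 1) (baseBox v) = depth k v := rfl

@[simp] theorem depth_copyBox :
    depth (k + 1) (copyBox P v) = depth k (leaf k P) + 1 + depth k v := rfl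

@[simp] theorem depth_addedBox : depth (k + 1) (addedBox P Q) = depth k (leaf k P) + 1 := rfl

@[simp] theorem lastBorn_copyBox : lastBorn (k + 1) (copyBox P v) = copyBox P (lastBorn k v) := rfl

@[simp] theorem chooses_baseBox_baseBox :
    Chooses (k + 1) (baseBox v) (baseBox w) ↔ Chooses k v w := .rfl

@[simp] theorem chooses_copyBox_copyBox :
    Chooses (k + 1) (copyBox P v) (copyBox P' w) ↔ P = P' ∧ Chooses k v w := .rfl

@[simp] theorem chooses_addedBox_copyBox :
    Chooses (k + 1) (addedBox P Q) (copyBox P' w) ↔ P = P' ∧ Stabs k Q w := .rfl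

@[simp] theorem not_chooses_baseBox_copyBox : ¬ Chooses (k + 1) (baseBox v) (copyBox P w) := id

@[simp] theorem not_chooses_copyBox_baseBox : ¬ Chooses (k + 1) (copyBox P v) (baseBox w) := id

@[simp] theorem not_chooses_addedBox_baseBox : ¬ Chooses (k + 1) (addedBox P Q) (baseBox w) := id

@[simp] theorem not_chooses_addedBox_right (u : BoxIdx (k + 1)) :
    ¬ Chooses (k + 1) u (addedBox P Q) := by
  rcases boxIdx_succ_cases u with ⟨u, rfl⟩ | ⟨P, u, rfl⟩ | ⟨P, Q, rfl⟩ <;> exact id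

end

/-! ### Parents, leaves and last-born children in the trees of the sequence. -/

theorem leaf_injective (k : ℕ) : Function.Injective (leaf k) := by
  induction k with
  | zero => exact fun P Q _ => Subsingleton.elim (α := Unit) P Q
  | succ k ih =>
    rintro ⟨P, Q, _ | _⟩ ⟨P', Q', _ | _⟩ h
    · obtain ⟨h, h'⟩ := copyBox_inj.1 h
      rw [h, ih h']
    · exact absurd h copyBox_ne_addedBox
    · exact absurd h addedBox_ne_copyBox
    · obtain ⟨h, h'⟩ := addedBox_inj.1 h
      rw [h, h']

theorem parent_eq_none_iff (k : ℕ) (v : BoxIdx k) : parent k v = none ↔ v = treeRoot k := by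
  induction k with
  | zero => exact ⟨fun _ => rfl, fun _ => rfl⟩
  | succ k ih =>
    rcases boxIdx_succ_cases v with ⟨v, rfl⟩ | ⟨P, v, rfl⟩ | ⟨P, Q, rfl⟩ <;> simp [treeRoot, ih]

@[simp] theorem parent_treeRoot (k : ℕ) : parent k (treeRoot k) = none :=
  (parent_eq_none_iff k _).2 rfl

/-- The three ways in which a vertex can have a parent. -/
theorem parent_succ_eq_some {k : ℕ} {u v : BoxIdx (k + 1)} (h : parent (k + 1) v = some u) :
    (∃ u' v', parent k v' = some u' ∧ v = baseBox v' ∧ u = baseBox u') ∨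
    (∃ P u' v', parent k v' = some u' ∧ v = copyBox P v' ∧ u = copyBox P u') ∨
    (∃ P, (v = copyBox P (treeRoot k) ∨ ∃ Q, v = addedBox P Q) ∧ u = baseBox (leaf k P)) := by
  rcases boxIdx_succ_cases v with ⟨v, rfl⟩ | ⟨P, v, rfl⟩ | ⟨P, Q, rfl⟩
  · rw [parent_baseBox] at h
    obtain ⟨u', h', rfl⟩ := Option.map_eq_some_iff.1 h
    exact .inl ⟨u', v, h', rfl, rfl⟩
  · cases hv : parent k v with
    | none =>
      simp only [parent_copyBox, hv, Option.elim_none, Option.some.injEq] at h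
      exact .inr (.inr ⟨P, .inl (by rw [(parent_eq_none_iff k v).1 hv]), h.symm⟩)
    | some u' =>
      simp only [parent_copyBox, hv, Option.elim_some, Option.some.injEq] at h
      exact .inr (.inl ⟨P, u', v, hv, rfl, h.symm⟩)
  · simp only [parent_addedBox, Option.some.injEq] at h
    exact .inr (.inr ⟨P, .inr ⟨Q, rfl⟩, h.symm⟩)

theorem depth_lt_of_parent (k : ℕ) (u v : BoxIdx k) (h : parent k v = some u) :
    depth k u < depth k v := by
  induction k with
  | zero => cases h
  | succ k ih =>
    rcases parent_succ_eq_some h with ⟨u, v, h', rfl, rfl⟩ | ⟨P, u, v, h', rfl, rfl⟩ |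
      ⟨P, rfl | ⟨Q, rfl⟩, rfl⟩
    · exact ih u v h'
    · have := ih u v h'
      simp only [depth_copyBox]
      omega
    · simp only [depth_baseBox, depth_copyBox]
      omega
    · simp only [depth_baseBox, depth_addedBox]
      omega

/-- New vertices are thus attached only where there were no children before, so the old last-born
children keep their role. -/
theorem parent_ne_leaf (k : ℕ) (v : BoxIdx k) (P : ProbeIdx k) : parent k v ≠ some (leaf k P) := by
  induction k with
  | zero => exact fun h => nomatch h
  | succ k ih =>
    intro h
    obtain ⟨P, Q, _ | _⟩ := P
    · change _ = some (copyBox P (leaf k Q)) at h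
      rcases parent_succ_eq_some h with ⟨u, v, h', -, e⟩ | ⟨P', u, v, h', -, e⟩ | ⟨P', -, e⟩
      · exact copyBox_ne_baseBox e
      · exact ih v Q (by rw [(copyBox_inj.1 e).2, h'])
      · exact copyBox_ne_baseBox e
    · change _ = some (addedBox P Q) at h
      rcases parent_succ_eq_some h with ⟨u, v, h', -, e⟩ | ⟨P', u, v, h', -, e⟩ | ⟨P', -, e⟩
      · exact addedBox_ne_baseBox e
      · exact addedBox_ne_copyBox e
      · exact addedBox_ne_baseBox e

theorem lastBorn_baseBox_leaf (k : ℕ) (P : ProbeIdx k) :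
    lastBorn (k + 1) (baseBox (leaf k P)) = copyBox P (treeRoot k) := by
  have h : ∃ P', leaf k P' = leaf k P := ⟨P, rfl⟩
  have h' : lastBorn (k + 1) (baseBox (leaf k P)) = copyBox h.choose (treeRoot k) := dif_pos h
  rw [h', leaf_injective k h.choose_spec]

theorem lastBorn_baseBox_of_parent {k : ℕ} {u v : BoxIdx k} (h : parent k v = some u) :
    lastBorn (k + 1) (baseBox u) = baseBox (lastBorn k u) := by
  refine dif_neg ?_
  rintro ⟨P, rfl⟩
  exact parent_ne_leaf k v P h

theorem parent_lastBorn (k : ℕ) (u v : BoxIdx k) (h : parent k v = some u) :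
    parent k (lastBorn k u) = some u := by
  induction k with
  | zero => cases h
  | succ k ih =>
    rcases parent_succ_eq_some h with ⟨u, v, h', rfl, rfl⟩ | ⟨P, u, v, h', rfl, rfl⟩ | ⟨P, -, rfl⟩
    · simp [lastBorn_baseBox_of_parent h', ih u v h']
    · simp [ih u v h']
    · simp [lastBorn_baseBox_leaf]

/-- This serves the root of the tree and also the roots of attached copies, which become last-born.
-/
theorem not_chooses_treeRoot (k : ℕ) (w : BoxIdx k) : ¬ Chooses k (treeRoot k) w := by
  induction k with
  | zero => exact id
  | succ k ih =>
    rcases boxIdx_succ_cases w with ⟨w, rfl⟩ | ⟨P, w, rfl⟩ | ⟨P, Q, rfl⟩ <;> simp [treeRoot, ih]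

theorem not_chooses_lastBorn (k : ℕ) (u v w : BoxIdx k) (h : parent k v = some u) :
    ¬ Chooses k (lastBorn k u) w := by
  induction k with
  | zero => cases h
  | succ k ih =>
    rcases boxIdx_succ_cases w with ⟨w, rfl⟩ | ⟨P', w, rfl⟩ | ⟨P', Q', rfl⟩ <;>
    rcases parent_succ_eq_some h with ⟨u, v, h', rfl, rfl⟩ | ⟨P, u, v, h', rfl, rfl⟩ | ⟨P, -, rfl⟩
    all_goals
      first
      | simp [lastBorn_baseBox_of_parent h', ih u v _ h']
      | simp [ih u v _ h']
      | simp [lastBorn_baseBox_leaf, not_chooses_treeRoot]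

/-! ### Stable sets and chosen sets as branches. -/

theorem isChain_map_baseBox {k : ℕ} {B : List (BoxIdx k)}
    (h : B.IsChain fun u v => parent k v = some u) :
    (B.map baseBox).IsChain fun u v => parent (k + 1) v = some u := by
  rw [List.isChain_map]
  exact h.imp fun u v h => by simp [h]

theorem isChain_map_copyBox {k : ℕ} (P : ProbeIdx k) {B : List (BoxIdx k)}
    (h : B.IsChain fun u v => parent k v = some u) :
    (B.map (copyBox P)).IsChain fun u v => parent (k + 1) v = some u := by
  rw [List.isChain_map]
  exact h.imp fun u v h => by simp [h]

/-- The stable set of a probe is the principal branch that ends at the leaf of the probe. -/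
theorem exists_branch_stabs (k : ℕ) (P : ProbeIdx k) :
    ∃ B : List (BoxIdx k), B.IsChain (fun u v => parent k v = some u) ∧
      B.head? = some (treeRoot k) ∧ B.getLast? = some (leaf k P) ∧ ∀ v, v ∈ B ↔ Stabs k P v := by
  induction k with
  | zero =>
    refine ⟨[treeRoot 0], .singleton _, rfl, rfl, fun v => ?_⟩
    exact ⟨fun _ => trivial, fun _ => List.mem_singleton.2 rfl⟩
  | succ k ih =>
    obtain ⟨P, Q, b⟩ := P
    change ∃ B : List (BoxIdx (k + 1)), B.IsChain (fun u v => parent (k + 1) v = some u) ∧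
      B.head? = some (treeRoot (k + 1)) ∧ B.getLast? = some (leaf (k + 1) (nextProbe P Q b)) ∧
      ∀ v, v ∈ B ↔ Stabs (k + 1) (nextProbe P Q b) v
    obtain ⟨B, hB, hhead, hlast, hmem⟩ := ih P
    cases b with
    | false =>
      obtain ⟨B', hB', hhead', hlast', hmem'⟩ := ih Q
      -- The two branches join because the root of the copy attached for `P` is a child of the leaf
      -- of `P`.
      refine ⟨B.map baseBox ++ B'.map (copyBox P), ?_, ?_, ?_, fun v => ?_⟩
      · exact List.isChain_append.2 ⟨isChain_map_baseBox hB, isChain_map_copyBox P hB',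
          by simp [hlast, hhead']⟩
      · simp [hhead, treeRoot]
      · simp [hlast']
      · rcases boxIdx_succ_cases v with ⟨v, rfl⟩ | ⟨P', v, rfl⟩ | ⟨P', Q', rfl⟩
        · simp [hmem]
        · simp [hmem', eq_comm, and_comm]
        · simp
    | true =>
      refine ⟨B.map baseBox ++ [addedBox P Q], ?_, ?_, ?_, fun v => ?_⟩
      · exact List.isChain_append.2 ⟨isChain_map_baseBox hB, .singleton _, by simp [hlast]⟩
      · simp [hhead, treeRoot]
      · simp
      · rcases boxIdx_succ_cases v with ⟨v, rfl⟩ | ⟨P', v, rfl⟩ | ⟨P', Q', rfl⟩ <;> simp [hmem]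

/-- The only new choosers are the added boxes. The box of `P, Q` chooses the copy of the branch of
`Q`, which starts at the root of the copy, the last-born of the leaf of `P`. -/
theorem exists_branch_chooses (k : ℕ) (u v : BoxIdx k) (h : parent k v = some u)
    (hne : v ≠ lastBorn k u) :
    ∃ B : List (BoxIdx k), B.IsChain (fun u v => parent k v = some u) ∧
      (B = [] ∨ B.head? = some (lastBorn k u)) ∧ ∀ w, Chooses k v w ↔ w ∈ B := by
  induction k with
  | zero => cases h
  | succ k ih =>
    rcases parent_succ_eq_some h with ⟨u, v, h', rfl, rfl⟩ | ⟨P, u, v, h', rfl, rfl⟩ |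
      ⟨P, rfl | ⟨Q, rfl⟩, rfl⟩
    · rw [lastBorn_baseBox_of_parent h'] at hne ⊢
      obtain ⟨B, hB, hhead, hmem⟩ := ih u v h' fun e => hne (by rw [e])
      refine ⟨B.map baseBox, isChain_map_baseBox hB, hhead.imp (fun e => by simp [e])
        fun e => by simp [e], fun w => ?_⟩
      rcases boxIdx_succ_cases w with ⟨w, rfl⟩ | ⟨P', w, rfl⟩ | ⟨P', Q', rfl⟩ <;> simp [hmem]
    · obtain ⟨B, hB, hhead, hmem⟩ := ih u v h' fun e => hne (by rw [e, lastBorn_copyBox])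
      refine ⟨B.map (copyBox P), isChain_map_copyBox P hB, hhead.imp (fun e => by simp [e])
        fun e => by simp [e], fun w => ?_⟩
      rcases boxIdx_succ_cases w with ⟨w, rfl⟩ | ⟨P', w, rfl⟩ | ⟨P', Q', rfl⟩ <;>
        simp [hmem, and_comm]
    · exact absurd (lastBorn_baseBox_leaf k P).symm hne
    · obtain ⟨B, hB, hhead, -, hmem⟩ := exists_branch_stabs k Q
      refine ⟨B.map (copyBox P), isChain_map_copyBox P hB,
        .inr (by simp [hhead, lastBorn_baseBox_leaf]), fun w => ?_⟩
      rcases boxIdx_succ_cases w with ⟨w, rfl⟩ | ⟨P', w, rfl⟩ | ⟨P', Q', rfl⟩ <;>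
        simp [hmem, and_comm]

/-! ### Assembly of the Burling tree. -/

theorem parent_ne_self (k : ℕ) (v : BoxIdx k) : parent k v ≠ some v :=
  fun h => (depth_lt_of_parent k v v h).false

/-- The rooted tree of the Burling sequence. -/
def rootedTree (k : ℕ) : TreeWithRoot (BoxIdx k) where
  tree := TreeWithRoot.parentGraph (parent k) (parent_ne_self k)
  isTree := TreeWithRoot.isTree_parentGraph (parent_eq_none_iff k) (depth_lt_of_parent k)
  root := treeRoot k

theorem rootedTree_isParent_iff {k : ℕ} {u v : BoxIdx k} :
    (rootedTree k).IsParent u v ↔ parent k v = some u :=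
  TreeWithRoot.isParent_iff_par (hpar := parent_ne_self k) rfl
    (fun v => (parent_eq_none_iff k v).1) (depth_lt_of_parent k)

theorem rootedTree_not_isLeaf_iff {k : ℕ} {u : BoxIdx k} :
    ¬ (rootedTree k).IsLeaf u ↔ ∃ v, parent k v = some u := by
  simp only [TreeWithRoot.IsLeaf, rootedTree_isParent_iff, not_forall, not_not]

/-- The Burling tree of the Burling sequence. -/
noncomputable def burlingTree (k : ℕ) : BurlingTree (BoxIdx k) where
  toTreeWithRoot := rootedTree k
  lastBorn := lastBorn k
  isParent_lastBorn u hu := by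
    obtain ⟨v, hv⟩ := rootedTree_not_isLeaf_iff.1 hu
    exact rootedTree_isParent_iff.2 (parent_lastBorn k u v hv)
  choose u := {w | Chooses k u w}
  choose_of_ne_lastBorn u v h hne := by
    obtain ⟨B, hB, hhead, hmem⟩ := exists_branch_chooses k u v (rootedTree_isParent_iff.1 h) hne
    exact ⟨B, hB.imp fun _ _ => rootedTree_isParent_iff.2, hhead, Set.ext hmem⟩
  choose_lastBorn u hu := by
    obtain ⟨v, hv⟩ := rootedTree_not_isLeaf_iff.1 hu
    exact Set.eq_empty_of_forall_notMem fun w => not_chooses_lastBorn k u v w hv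
  choose_root := Set.eq_empty_of_forall_notMem (not_chooses_treeRoot k)

theorem burlingSequence_eq_derivedGraph (k : ℕ) :
    burlingSequence k = (burlingTree k).derivedGraph := by
  ext u v
  rw [burlingSequence_adj, abstractAdj_iff_chooses, BurlingTree.derivedGraph_adj]
  rfl

end Burling

theorem burlingGraphs_subset_graphIntersection :
    burlingGraphs ⊆ graphIntersection triviallyPerfectGraphs burlingStronglyChordalGraphs := by
  rintro G ⟨k, ⟨φ⟩⟩
  rw [Burling.burlingSequence_eq_derivedGraph] at φ
  exact BurlingTree.mem_graphIntersection φ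

/-- The Burling strongly chordal graphs form a (hereditary) proper subclass of the strongly chordal
graphs, and the class of Burling graphs is a subclass of the graph-intersection of the class of
trivially perfect graphs with this class. -/
theorem mainTheorem5 :
    IsHereditary burlingStronglyChordalGraphs ∧
    burlingStronglyChordalGraphs ⊂ stronglyChordalGraphs ∧
    burlingGraphs ⊆ graphIntersection triviallyPerfectGraphs burlingStronglyChordalGraphs :=
  ⟨isHereditary_burlingStronglyChordalGraphs, burlingStronglyChordalGraphs_ssubset,
    burlingGraphs_subset_graphIntersection⟩
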